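/- Theorem (directed formation tracking, leader with bounded input). Let $A\in\mathbb R^{n\times n}$, $B\in\mathbb R^{n\times p}$, $C\in\mathbb R^{q\times n}$ with $(A,B)$ stabilizable and $(A,C)$ detectable. Consider a leader, agent $0$, and followers $1,\dots,N$ with dynamics $$\dot x_i=Ax_i+Bu_i,\qquad y_i=Cx_i,\qquad i=0,\dots,N .$$ Communication is described by weights $a_{ij}\ge 0$ ($0\le i,j\le N$), where $a_{ij}>0$ means that there is an edge from $j$ to $i$, i.e. agent $i$ receives information from agent $j$ (the case $a_{ij}\in\{0,1\}$ is included). The leader receives no information, $a_{0j}=0$, and the graph contains a directed spanning tree rooted at the leader, i.e. there is a directed path from $0$ to every follower. The leader's input satisfies $\|u_0(t)\|\le\epsilon$ for all $t\ge0$, with a constant $\epsilon>0$. The time-varying formation shape is given by functions $h_1,\dots,h_N$ with values in $\mathbb R^n$ such that $\dot h_i(t)=(A+BK_1)h_i(t)$ for all $t>0$ apart from finitely many switching times, at which $h_i$ may jump; $K_1\in\mathbb R^{p\times n}$ is a constant matrix. Let $z(x)=x/\|x\|$ for $x\neq0$ and $z(0)=0$ (Euclidean norm). For each follower $i$ consider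 the protocol $$\begin{aligned} u_i&=K_1h_i+K_2v_i-\beta z(B^TS\eta_i),\\ \dot w_i&=Aw_i+Bu_i-BK_1h_i+F[Cw_i-(y_i-Ch_i)],\\ \dot v_i&=Av_i+B[u_i-\beta z(B^TQ\varrho_i)]-BK_1h_i+(c_i+\rho_i)FC\varrho_i+F[Cw_i-(y_i-Ch_i)],\\ \dot c_i&=\varrho_i^TC^T\Gamma C\varrho_i,\qquad c_i(0)\ge1, \end{aligned}$$ where $$\psi_i=\sum_{j=0}^N a_{ij}(v_i-v_j),\quad \eta_i=\sum_{j=0}^N a_{ij}(w_i-w_j),\quad \varrho_i=\psi_i-\eta_i,\quad \rho_i=\varrho_i^TQ\varrho_i,$$ and for the leader $v_0=0$ and $\dot w_0=Aw_0+Bu_0+F(Cw_0-y_0)$. Since $z$ is discontinuous, solutions are understood in the sense of Filippov: all signals are locally absolutely continuous, and the equations hold for almost every $t$ with each value $z(\cdot)$ replaced, where its argument is $0$, by some vector of the closed unit ball. (Every Carathéodory solution is of this kind.) Suppose that $A+BK_2$ is Hurwitz, $\Gamma=I$, $F=-Q^{-1}C^T$, where $Q>0$ is symmetric with $QA+A^TQ-2C^TC<0$,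 that $\beta\ge\epsilon$, and that $S>0$ is symmetric with $S(A+BK_2)+(A+BK_2)^TS<0$. Then: 1. every solution on a bounded time interval $[0,T)$, $0<T<\infty$, is bounded on $[0,T)$ (no finite escape time); 2. every solution on $[0,\infty)$, whatever the initial values $x_i(0),w_i(0),v_i(0)$ and $c_i(0)\ge 1$, achieves output time-varying formation tracking, $$\lim_{t\to\infty}\|y_i(t)-y_0(t)-Ch_i(t)\|=0,\qquad i=1,\dots,N,$$ and each coupling weight $c_i(t)$, $i=1,\dots,N$, converges to a finite limit as $t\to\infty$. -/

import Mathlib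

open scoped Matrix

namespace FormationTracking

/-- Real column vectors with the Euclidean norm. -/
abbrev Vec (n : ℕ) : Type := EuclideanSpace ℝ (Fin n)

/-- Matrix times column vector. -/
noncomputable abbrev matVec {m n : ℕ} (M : Matrix (Fin m) (Fin n) ℝ) (x : Vec n) : Vec m :=
  Matrix.toEuclideanLin M x

infixr:73 " *ₑ " => matVec

/-- All (complex) eigenvalues of the real matrix have negative real part. -/
def IsHurwitz {n : ℕ} (M : Matrix (Fin n) (Fin n) ℝ) : Prop :=
  ∀ μ ∈ spectrum ℂ (M.map (algebraMap ℝ ℂ)), μ.re < 0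

/-- The common linear dynamics `ẋ = A x + B u`, `y = C x` of all agents. -/
structure Plant (n p q : ℕ) where
  A : Matrix (Fin n) (Fin n) ℝ
  B : Matrix (Fin n) (Fin p) ℝ
  C : Matrix (Fin q) (Fin n) ℝ

/-- Some state feedback makes `A + B K` Hurwitz. -/
def Plant.IsStabilizable {n p q : ℕ} (P : Plant n p q) : Prop :=
  ∃ K : Matrix (Fin p) (Fin n) ℝ, IsHurwitz (P.A + P.B * K)

/-- Some output injection makes `A + L C` Hurwitz. -/
def Plant.IsDetectable {n p q : ℕ} (P : Plant n p q) : Prop :=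
  ∃ L : Matrix (Fin n) (Fin q) ℝ, IsHurwitz (P.A + L * P.C)

/-- The design parameters of the adaptive protocol. -/
structure Gains (n p q : ℕ) where
  K₁ : Matrix (Fin p) (Fin n) ℝ
  K₂ : Matrix (Fin p) (Fin n) ℝ
  F : Matrix (Fin n) (Fin q) ℝ
  Γ : Matrix (Fin q) (Fin q) ℝ
  Q : Matrix (Fin n) (Fin n) ℝ
  S : Matrix (Fin n) (Fin n) ℝ
  β : ℝ

/-- There is a directed path from `r` to every node; agent `i` receives information from
agent `j`, i.e. there is an edge from `j` to `i`, exactly if `0 < a i j`. -/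
def HasSpanningTreeFrom {V : Type*} (a : Matrix V V ℝ) (r : V) : Prop :=
  ∀ i, Relation.ReflTransGen (fun j k => 0 < a k j) r i

/-- The shape signal `h` of one follower solves `ḣ = (A + B K₁) h` for `t > 0` apart from finitely
many switching times, at which it may jump. -/
def IsShapeSignal {n p q : ℕ} (P : Plant n p q) (K₁ : Matrix (Fin p) (Fin n) ℝ)
    (h : ℝ → Vec n) : Prop :=
  ∃ J : Finset ℝ, ∀ t : ℝ, 0 < t → t ∉ J → HasDerivAt h ((P.A + P.B * K₁) *ₑ h t) t

/-- The discontinuous function `z(x) = x / ‖x‖`, `z(0) = 0`. -/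
noncomputable def z {p : ℕ} (x : Vec p) : Vec p :=
  if ‖x‖ = 0 then 0 else ‖x‖⁻¹ • x

/-- The set-valued (Filippov) regularization of `z`: the singleton `{z x}` off the origin, and
the closed unit ball at the origin. -/
noncomputable def zSet {p : ℕ} (x : Vec p) : Set (Vec p) :=
  if x = 0 then Metric.closedBall 0 1 else {z x}

/-- Every value of `z` is allowed by the regularization. -/
theorem z_mem_zSet {p : ℕ} (x : Vec p) : z x ∈ zSet x := by
  by_cases hx : x = 0 <;> simp [z, zSet, hx]

/-- `f` is absolutely continuous on every compact subinterval of `I`. -/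
def LocallyAC {E : Type*} [PseudoMetricSpace E] (I : Set ℝ) (f : ℝ → E) : Prop :=
  ∀ s ∈ I, ∀ t ∈ I, AbsolutelyContinuousOnInterval f s t

/-- The time histories of the whole system. Agent `0` is the leader, the followers are
`1, …, N`, written `i.succ` with `i : Fin N`. -/
structure Histories (N n : ℕ) where
  /-- states of the agents -/
  x : Fin (N + 1) → ℝ → Vec n
  /-- local observers -/
  w : Fin (N + 1) → ℝ → Vec n
  /-- distributed observers -/
  v : Fin (N + 1) → ℝ → Vec n
  /-- adaptive coupling weights of the followers -/
  c : Fin N → ℝ → ℝ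

namespace Histories

variable {N n : ℕ} (X : Histories N n) (a : Matrix (Fin (N + 1)) (Fin (N + 1)) ℝ)

/-- `ψ_i = ∑_{j=0}^N a_ij (v_i - v_j)`. -/
noncomputable def ψ (i : Fin N) (t : ℝ) : Vec n :=
  ∑ j, a i.succ j • (X.v i.succ t - X.v j t)

/-- `η_i = ∑_{j=0}^N a_ij (w_i - w_j)`. -/
noncomputable def η (i : Fin N) (t : ℝ) : Vec n :=
  ∑ j, a i.succ j • (X.w i.succ t - X.w j t)

/-- `ϱ_i = ψ_i - η_i`. -/
noncomputable def ϱ (i : Fin N) (t : ℝ) : Vec n :=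
  X.ψ a i t - X.η a i t

/-- `ρ_i = ϱ_iᵀ Q ϱ_i`. -/
noncomputable def ρ (Q : Matrix (Fin n) (Fin n) ℝ) (i : Fin N) (t : ℝ) : ℝ :=
  inner ℝ (X.ϱ a i t) (Q *ₑ X.ϱ a i t)

end Histories

/-- The equations of the leader at time `t`: its dynamics with input `u₀`, and its observer. -/
def LeaderEquations {N n p q : ℕ} (P : Plant n p q) (G : Gains n p q) (u₀ : ℝ → Vec p)
    (X : Histories N n) (t : ℝ) : Prop :=
  HasDerivAt (X.x 0) (P.A *ₑ X.x 0 t + P.B *ₑ u₀ t) t ∧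
  HasDerivAt (X.w 0)
    (P.A *ₑ X.w 0 t + P.B *ₑ u₀ t + G.F *ₑ (P.C *ₑ X.w 0 t - P.C *ₑ X.x 0 t)) t

/-- The equations of follower `i` at time `t`, where `ζ₁` and `ζ₂` are the values used
for `z(Bᵀ S η_i)` and `z(Bᵀ Q (ψ_i - η_i))`, and where `u` is the control input. -/
def FollowerEquations {N n p q : ℕ} (P : Plant n p q) (G : Gains n p q)
    (a : Matrix (Fin (N + 1)) (Fin (N + 1)) ℝ) (h : Fin N → ℝ → Vec n)
    (X : Histories N n) (i : Fin N) (ζ₁ ζ₂ : Vec p) (t : ℝ) : Prop :=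
  let u : Vec p := G.K₁ *ₑ h i t + G.K₂ *ₑ X.v i.succ t - G.β • ζ₁
  let innov : Vec n :=
    G.F *ₑ (P.C *ₑ X.w i.succ t - (P.C *ₑ X.x i.succ t - P.C *ₑ h i t))
  HasDerivAt (X.x i.succ) (P.A *ₑ X.x i.succ t + P.B *ₑ u) t ∧
  HasDerivAt (X.w i.succ)
    (P.A *ₑ X.w i.succ t + P.B *ₑ u - P.B *ₑ G.K₁ *ₑ h i t + innov) t ∧
  HasDerivAt (X.v i.succ)
    (P.A *ₑ X.v i.succ t + P.B *ₑ (u - G.β • ζ₂) - P.B *ₑ G.K₁ *ₑ h i t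
      + (X.c i t + X.ρ a G.Q i t) • (G.F *ₑ P.C *ₑ X.ϱ a i t) + innov) t ∧
  HasDerivAt (X.c i) (inner ℝ (P.C *ₑ X.ϱ a i t) (G.Γ *ₑ P.C *ₑ X.ϱ a i t)) t

/-- `X` is a solution, in the sense of Filippov, of the closed loop on the time interval `I`
(which is `[0, T)` or `[0, ∞)`): all signals are locally absolutely continuous, and the equations
hold at almost every time, with `z` replaced by its set-valued regularization. The initial values
are free except for `c_i(0) ≥ 1`. -/
structure IsClosedLoopSolution {N n p q : ℕ} (P : Plant n p q) (G : Gains n p q)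
    (a : Matrix (Fin (N + 1)) (Fin (N + 1)) ℝ) (h : Fin N → ℝ → Vec n) (u₀ : ℝ → Vec p)
    (I : Set ℝ) (X : Histories N n) : Prop where
  ac_x : ∀ j, LocallyAC I (X.x j)
  ac_w : ∀ j, LocallyAC I (X.w j)
  ac_v : ∀ j, LocallyAC I (X.v j)
  ac_c : ∀ i, LocallyAC I (X.c i)
  leader_v : ∀ t ∈ I, X.v 0 t = 0
  init_c : ∀ i, 1 ≤ X.c i 0
  leader : ∀ᵐ t : ℝ, t ∈ I → LeaderEquations P G u₀ X t
  followers : ∀ᵐ t : ℝ, t ∈ I → ∀ i : Fin N,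
    ∃ ζ₁ ∈ zSet (P.Bᵀ *ₑ G.S *ₑ X.η a i t),
    ∃ ζ₂ ∈ zSet (P.Bᵀ *ₑ G.Q *ₑ X.ϱ a i t),
      FollowerEquations P G a h X i ζ₁ ζ₂ t

end FormationTracking

/-!
The closed loop is analysed in three layers, all in terms of the Laplacian `lap` of the
communication graph, which turns signals of all agents into relative signals of the followers.

*Local observers.* The error `w_j - (x_j - h_j)` (with `h_0 = 0`) obeys `ė = (A + F C) e` between
the jumps of `h_j`. The matrix inequality for `Q` says that `⟨e, Q e⟩` decays exponentially, so
finitely many jumps leave the error bounded and, after the last one, it vanishes asymptotically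
(`observerError_bound`, `IsShapeSignal.exists_bound`).

*Distributed observers.* The relative errors satisfy `ϱ = lap (v - w)` and
`ϱ̇ = A ϱ + B lap d + F lap σ`. Here `σ_i = (c_i + ρ_i) C ϱ_i`, `σ_0 = -C e₀` carries the leader's
observer error, `d_i = -β ζ_i` is the unit vector feedback, and `d_0 = -u₀` is the leader's input. Row by row, `⟨BᵀQϱ_i, lap d⟩ ≤ 0` because
`β` dominates the leader's input (`inner_lap_nonpos`). A discrete maximum principle, which uses the
spanning tree, shows that the follower block `L` of the Laplacian has a nonnegative inverse; with
`L r = 1` and `lᵀ L = 1`, the weights `g = l / r` make `G L + Lᵀ G` positive definite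
(`exists_lap_coercive`). Hence the energy `V = ∑ g_i (c_i ρ_i + ρ_i² / 2) + μ ⟨e₀, Q e₀⟩` satisfies
`V̇ ≤ -k V + ∑ (α - c_i) ċ_i` (`exists_couplingEnergy_dissipation`). So
`V + ∑ (c_i - α)² / 2` is antitone, the monotone weights `c_i` are bounded and converge, and then
the same inequality, whose last term is the derivative of a convergent function, forces `V → 0`
(`tendsto_zero_of_deriv_le`).

*Formation.* The relative states `η = lap w` are driven by `ϱ` and by the observer errors through
the matrix `A + B K₂`, for which `S` is a Lyapunov matrix, again up to a unit vector feedback that dominates the leader's input;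
`⟨η, S η⟩` yields `η → 0`. The Laplacian controls the deviations from the leader
(`exists_norm_sub_le_lap`), which gives the tracking of the formation.

Solutions are only absolutely continuous, so every differential inequality holds almost everywhere
and is integrated by means of `LocallyAC.antitoneOn`.
-/

namespace FormationTracking

open Set Filter Topology MeasureTheory

/-! ### Absolutely continuous functions on an interval -/

section LocallyAC

variable {I : Set ℝ}

theorem LocallyAC.lipschitz_comp {E E' : Type*} [PseudoMetricSpace E] [PseudoMetricSpace E']
    {f : ℝ → E} (hf : LocallyAC I f) {φ : E → E'} {K : NNReal} (hφ : LipschitzWith K φ) :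
    LocallyAC I (fun t => φ (f t)) := by
  intro s hs t ht
  have h := (hf s hs t ht)
  refine squeeze_zero (fun E => Finset.sum_nonneg fun i _ => dist_nonneg) (fun E => ?_)
    (by simpa using Tendsto.const_mul (K : ℝ) h)
  rw [Finset.mul_sum]
  exact Finset.sum_le_sum fun i _ => hφ.dist_le_mul _ _

theorem LocallyAC.mono {E : Type*} [PseudoMetricSpace E] {f : ℝ → E} {J : Set ℝ}
    (hf : LocallyAC I f) (hJ : J ⊆ I) : LocallyAC J f :=
  fun s hs t ht => hf s (hJ hs) t (hJ ht)

theorem LocallyAC.continuousOn {E : Type*} [SeminormedAddCommGroup E] {f : ℝ → E} {s t : ℝ}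
    (hf : LocallyAC I f) (hs : s ∈ I) (ht : t ∈ I) (hst : s ≤ t) : ContinuousOn f (Icc s t) := by
  simpa [uIcc_of_le hst] using (hf s hs t ht).continuousOn

section Normed

variable {E : Type*} [NormedAddCommGroup E] {f g : ℝ → E}

theorem locallyAC_const (x : E) : LocallyAC I (fun _ => x) := fun _ _ _ _ =>
  (LipschitzWith.const x : LipschitzWith 0 fun _ : ℝ => x).lipschitzOnWith
    |>.absolutelyContinuousOnInterval

theorem LocallyAC.add (hf : LocallyAC I f) (hg : LocallyAC I g) :
    LocallyAC I (fun t => f t + g t) :=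
  fun s hs t ht => (hf s hs t ht).add (hg s hs t ht)

theorem LocallyAC.sub (hf : LocallyAC I f) (hg : LocallyAC I g) :
    LocallyAC I (fun t => f t - g t) :=
  fun s hs t ht => (hf s hs t ht).sub (hg s hs t ht)

theorem LocallyAC.sum {ι : Type*} {F : ι → ℝ → E} (u : Finset ι)
    (hF : ∀ i ∈ u, LocallyAC I (F i)) : LocallyAC I (fun t => ∑ i ∈ u, F i t) := by
  classical
  induction u using Finset.induction_on with
  | empty => simpa using locallyAC_const (I := I) (0 : E)
  | insert i u hi ih =>
    simp only [Finset.sum_insert hi]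
    exact (hF i (by simp)).add (ih fun j hj => hF j (by simp [hj]))

variable [NormedSpace ℝ E]

theorem LocallyAC.const_smul (r : ℝ) (hf : LocallyAC I f) : LocallyAC I (fun t => r • f t) :=
  fun s hs t ht => (hf s hs t ht).const_smul r

theorem LocallyAC.const_mul {f : ℝ → ℝ} (r : ℝ) (hf : LocallyAC I f) :
    LocallyAC I (fun t => r * f t) :=
  hf.const_smul r

theorem LocallyAC.mul {f g : ℝ → ℝ} (hf : LocallyAC I f) (hg : LocallyAC I g) :
    LocallyAC I (fun t => f t * g t) :=
  fun s hs t ht => (hf s hs t ht).mul (hg s hs t ht)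

theorem locallyAC_of_contDiff [OrdConnected I] {f : ℝ → E} (hf : ContDiff ℝ 1 f) :
    LocallyAC I f := by
  intro s hs t ht
  obtain ⟨K, hK⟩ := (hf.contDiffOn (s := uIcc s t)).exists_lipschitzOnWith one_ne_zero
    (convex_uIcc s t) isCompact_uIcc
  exact hK.absolutelyContinuousOnInterval

/-- A function that is differentiable with bounded derivative on an interval is absolutely
continuous there. -/
theorem locallyAC_of_hasDerivAt [hI : OrdConnected I] {f f' : ℝ → E} {K : ℝ}
    (hf : ∀ t ∈ I, HasDerivAt f (f' t) t) (hK : ∀ t ∈ I, ‖f' t‖ ≤ K) : LocallyAC I f := by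
  intro s hs t ht
  have hsub := hI.uIcc_subset hs ht
  have : LipschitzOnWith K.toNNReal f (uIcc s t) :=
    (convex_uIcc s t).lipschitzOnWith_of_nnnorm_hasDerivWithin_le
      (fun x hx => (hf x (hsub hx)).hasDerivWithinAt)
      fun x hx => by
        rw [← NNReal.coe_le_coe, coe_nnnorm]
        exact (hK x (hsub hx)).trans (Real.le_coe_toNNReal K)
  exact this.absolutelyContinuousOnInterval

end Normed

theorem LocallyAC.matVec {m n : ℕ} {f : ℝ → Vec n} (hf : LocallyAC I f)
    (M : Matrix (Fin m) (Fin n) ℝ) : LocallyAC I (fun t => M *ₑ f t) :=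
  hf.lipschitz_comp (LinearMap.toContinuousLinearMap (Matrix.toEuclideanLin M)).lipschitz

theorem LocallyAC.inner {n : ℕ} {f g : ℝ → Vec n} (hf : LocallyAC I f) (hg : LocallyAC I g) :
    LocallyAC I (fun t => inner ℝ (f t) (g t)) := by
  have hc : ∀ {f : ℝ → Vec n}, LocallyAC I f → ∀ i, LocallyAC I (fun t => f t i) :=
    fun hf i => hf.lipschitz_comp (EuclideanSpace.proj (𝕜 := ℝ) i).lipschitz
  simp only [PiLp.inner_apply, RCLike.inner_apply, conj_trivial]
  exact LocallyAC.sum _ fun i _ => (hc hg i).mul (hc hf i)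

/-- An absolutely continuous function whose derivative is nonpositive almost everywhere is
antitone: it is the integral of its derivative. -/
theorem LocallyAC.antitoneOn [hI : OrdConnected I] {f : ℝ → ℝ} (hf : LocallyAC I f)
    (hf' : ∀ᵐ t : ℝ, t ∈ I → ∃ d, HasDerivAt f d t ∧ d ≤ 0) : AntitoneOn f I := by
  intro s hs t ht hst
  have h := (hf s hs t ht).integral_deriv_eq_sub
  have h0 : ∫ x in s..t, deriv f x ≤ 0 := by
    rw [intervalIntegral.integral_of_le hst]
    refine integral_nonpos_of_ae ?_
    rw [EventuallyLE, ae_restrict_iff' measurableSet_Ioc]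
    filter_upwards [hf'] with x hx hxI
    obtain ⟨d, hd, hd0⟩ := hx (hI.out hs ht (Ioc_subset_Icc_self hxI))
    simpa [hd.deriv] using hd0
  linarith

theorem LocallyAC.monotoneOn [OrdConnected I] {f : ℝ → ℝ} (hf : LocallyAC I f)
    (hf' : ∀ᵐ t : ℝ, t ∈ I → ∃ d, HasDerivAt f d t ∧ 0 ≤ d) : MonotoneOn f I := by
  have h := (hf.const_mul (-1)).antitoneOn (by
    filter_upwards [hf'] with t ht hI
    obtain ⟨d, hd, h0⟩ := ht hI
    exact ⟨-1 * d, hd.const_mul _, by linarith⟩)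
  intro s hs t ht hst
  have := h hs ht hst
  simp only at this
  linarith

end LocallyAC

/-! ### Differential inequalities -/

section Inequalities

variable {I : Set ℝ}

/-- Grönwall's inequality `V' ≤ -k V`, in the form that `V e^{kt}` is antitone. -/
theorem LocallyAC.antitoneOn_mul_exp [OrdConnected I] {V : ℝ → ℝ} {k : ℝ} (hV : LocallyAC I V)
    (hV' : ∀ᵐ t : ℝ, t ∈ I → ∃ d, HasDerivAt V d t ∧ d ≤ -k * V t) :
    AntitoneOn (fun t => V t * Real.exp (k * t)) I := by
  refine LocallyAC.antitoneOn (hV.mul (locallyAC_of_contDiff (by fun_prop))) ?_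
  filter_upwards [hV'] with t ht hI
  obtain ⟨d, hd, hle⟩ := ht hI
  refine ⟨_, hd.mul (((hasDerivAt_id t).const_mul k).exp), ?_⟩
  have := mul_nonpos_of_nonpos_of_nonneg (by linarith : d + k * V t ≤ 0)
    (Real.exp_pos (k * t)).le
  simp only [id]
  linarith

/-- If `V' ≤ -k V + φ' + r` almost everywhere, where `φ` converges and `r` tends to `0`, then
`limsup V ≤ 0`. -/
theorem eventually_le_of_deriv_le {V φ r : ℝ → ℝ} {k φ' : ℝ} (hk : 0 < k)
    (hV : LocallyAC (Ici 0) V) (hφ : LocallyAC (Ici 0) φ) (hφl : Tendsto φ atTop (𝓝 φ'))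
    (hr : Tendsto r atTop (𝓝 0))
    (h : ∀ᵐ t : ℝ, t ∈ Ici (0 : ℝ) → ∃ d dφ, HasDerivAt V d t ∧ HasDerivAt φ dφ t ∧
      d ≤ -k * V t + dφ + r t) {δ : ℝ} (hδ : 0 < δ) :
    ∀ᶠ t in atTop, V t ≤ δ := by
  -- For `κ` small and `t` large, `Y = V - φ + φ' - 2 κ` satisfies `Y' ≤ -k Y`.
  set κ := δ / 4 with hκ
  have hκ0 : 0 < κ := by positivity
  obtain ⟨T, hT⟩ := eventually_atTop.1
    (((hφl.eventually (Ioo_mem_nhds (by linarith : φ' - κ < φ') (by linarith : φ' < φ' + κ))).and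
      (hr.eventually (gt_mem_nhds (mul_pos hk hκ0)))).and (eventually_ge_atTop 0))
  have hT0 : (0 : ℝ) ≤ T := (hT T le_rfl).2
  have hanti := LocallyAC.antitoneOn_mul_exp (I := Ici T) (k := k)
    (V := fun t => V t - φ t + (φ' - 2 * κ))
    (((hV.sub hφ).add (locallyAC_const _)).mono (Ici_subset_Ici.2 hT0)) (by
      filter_upwards [h] with t ht htT
      obtain ⟨d, dφ, hd, hdφ, hle⟩ := ht (hT0.trans htT)
      obtain ⟨⟨h1, h2⟩, -⟩ := hT t htT
      refine ⟨_, (hd.sub hdφ).add_const _, ?_⟩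
      have := mul_lt_mul_of_pos_left h1.1 hk
      linarith)
  have hlim : Tendsto (fun t => (V T - φ T + (φ' - 2 * κ)) * Real.exp (k * T) *
      Real.exp (-(k * t))) atTop (𝓝 0) := by
    rw [← mul_zero ((V T - φ T + (φ' - 2 * κ)) * Real.exp (k * T))]
    exact (Real.tendsto_exp_neg_atTop_nhds_zero.comp
      (tendsto_id.const_mul_atTop hk)).const_mul _
  filter_upwards [eventually_ge_atTop T, hlim.eventually (gt_mem_nhds hκ0)] with t ht hlt
  have h1 := hanti self_mem_Ici ht ht
  obtain ⟨⟨h2, -⟩, -⟩ := hT t ht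
  simp only at h1
  have h3 := mul_le_mul_of_nonneg_right h1 (Real.exp_pos (-(k * t))).le
  rw [mul_assoc, ← Real.exp_add, add_neg_cancel, Real.exp_zero, mul_one] at h3
  linarith [h2.2]

theorem tendsto_zero_of_deriv_le {V φ r : ℝ → ℝ} {k φ' : ℝ} (hk : 0 < k)
    (hV : LocallyAC (Ici 0) V) (hV0 : ∀ t ∈ Ici 0, 0 ≤ V t)
    (hφ : LocallyAC (Ici 0) φ) (hφl : Tendsto φ atTop (𝓝 φ'))
    (hr : Tendsto r atTop (𝓝 0))
    (h : ∀ᵐ t : ℝ, t ∈ Ici (0 : ℝ) → ∃ d dφ, HasDerivAt V d t ∧ HasDerivAt φ dφ t ∧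
      d ≤ -k * V t + dφ + r t) :
    Tendsto V atTop (𝓝 0) := by
  refine tendsto_order.2 ⟨fun b hb => ?_, fun b hb => ?_⟩
  · filter_upwards [eventually_ge_atTop 0] with t ht using hb.trans_le (hV0 t ht)
  · filter_upwards [eventually_le_of_deriv_le hk hV hφ hφl hr h (half_pos hb)] with t ht
    linarith

end Inequalities

/-! ### Time intervals and switched shape signals -/

/-- An interval of times that starts at `0` and has no last point: `[0, T)` or `[0, ∞)`. -/
structure IsTimeInterval (I : Set ℝ) : Prop where
  zero_mem : 0 ∈ I
  ordConnected : OrdConnected I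
  nonneg : ∀ t ∈ I, 0 ≤ t
  exists_gt : ∀ t ∈ I, ∃ s ∈ I, t < s

theorem isTimeInterval_Ici : IsTimeInterval (Ici 0) :=
  ⟨self_mem_Ici, ordConnected_Ici, fun _ h => h, fun t ht =>
    ⟨t + 1, mem_Ici.2 (by linarith [mem_Ici.1 ht]), by linarith⟩⟩

theorem isTimeInterval_Ico {T : ℝ} (hT : 0 < T) : IsTimeInterval (Ico 0 T) :=
  ⟨⟨le_rfl, hT⟩, ordConnected_Ico, fun _ h => h.1, fun t ht =>
    ⟨(t + T) / 2, ⟨by linarith [ht.1], by linarith [ht.2]⟩, by linarith [ht.2]⟩⟩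

namespace IsTimeInterval

variable {I : Set ℝ}

theorem mem_nhds (hI : IsTimeInterval I) {t : ℝ} (ht : t ∈ I) (h0 : 0 < t) : I ∈ 𝓝 t := by
  obtain ⟨s, hs, hts⟩ := hI.exists_gt t ht
  exact mem_of_superset (Icc_mem_nhds h0 hts) (hI.ordConnected.out hI.zero_mem hs)

theorem exists_forall_notMem (hI : IsTimeInterval I) (J : Finset ℝ) :
    ∃ τ ∈ I, 0 < τ ∧ ∀ t ∈ I, τ ≤ t → t ∉ J := by
  classical
  induction J using Finset.induction_on with
  | empty =>
    obtain ⟨s, hs, h⟩ := hI.exists_gt 0 hI.zero_mem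
    exact ⟨s, hs, h, by simp⟩
  | insert j J _ ih =>
    obtain ⟨τ, hτ, h0, h⟩ := ih
    by_cases hj : j ∈ I
    · have hm : max j τ ∈ I := by rcases max_choice j τ with h | h <;> rwa [h]
      obtain ⟨s, hs, hlt⟩ := hI.exists_gt _ hm
      obtain ⟨h1, h2⟩ := max_lt_iff.1 hlt
      refine ⟨s, hs, h0.trans h2, fun t ht hst => ?_⟩
      rw [Finset.mem_insert, not_or]
      exact ⟨(h1.trans_le hst).ne', h t ht (h2.le.trans hst)⟩
    · refine ⟨τ, hτ, h0, fun t ht hst => ?_⟩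
      rw [Finset.mem_insert, not_or]
      exact ⟨fun h => hj (h ▸ ht), h t ht hst⟩

theorem inter_Ici (hI : IsTimeInterval I) (τ : ℝ) : OrdConnected (I ∩ Ici τ) :=
  hI.ordConnected.inter ordConnected_Ici

end IsTimeInterval

section Linear

variable {n : ℕ}

theorem exists_matVec_bound {m : ℕ} (M : Matrix (Fin m) (Fin n) ℝ) :
    ∃ K : ℝ, 0 < K ∧ ∀ x : Vec n, ‖M *ₑ x‖ ≤ K * ‖x‖ := by
  refine ⟨‖LinearMap.toContinuousLinearMap (Matrix.toEuclideanLin M)‖ + 1, by positivity,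
    fun x => ((LinearMap.toContinuousLinearMap (Matrix.toEuclideanLin M)).le_opNorm x).trans ?_⟩
  gcongr
  linarith

theorem hasDerivAt_norm_sq {f : ℝ → Vec n} {f' : Vec n} {t : ℝ} (hf : HasDerivAt f f' t) :
    HasDerivAt (fun t => ‖f t‖ ^ 2) (2 * inner ℝ (f t) f') t :=
  hf.norm_sq

/-- A solution of a linear differential equation stays bounded towards both ends of a bounded open
interval. -/
theorem exists_bound_Ioo_of_hasDerivAt (M : Matrix (Fin n) (Fin n) ℝ) {f : ℝ → Vec n} {a b : ℝ}
    (hf : ∀ t ∈ Ioo a b, HasDerivAt f (M *ₑ f t) t) : ∃ K, ∀ t ∈ Ioo a b, ‖f t‖ ≤ K := by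
  rcases le_or_gt b a with hab | hab
  · exact ⟨0, fun t ht => absurd (ht.1.trans ht.2) hab.not_gt⟩
  obtain ⟨L, hL, hM⟩ := exists_matVec_bound M
  have habs : ∀ t, |2 * inner ℝ (f t) (M *ₑ f t)| ≤ 2 * L * ‖f t‖ ^ 2 := fun t => by
    have h1 := abs_real_inner_le_norm (f t) (M *ₑ f t)
    have h2 := mul_le_mul_of_nonneg_left (hM (f t)) (norm_nonneg (f t))
    rw [abs_mul, abs_two]
    nlinarith
  have hderiv : ∀ c : ℝ, ∀ t ∈ Ioo a b,
      HasDerivAt (fun t => ‖f t‖ ^ 2 * Real.exp (c * t))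
        (2 * inner ℝ (f t) (M *ₑ f t) * Real.exp (c * t)
          + ‖f t‖ ^ 2 * (Real.exp (c * t) * (c * 1))) t := fun c t ht =>
    (hasDerivAt_norm_sq (hf t ht)).mul (((hasDerivAt_id t).const_mul c).exp)
  have hanti : AntitoneOn (fun t => ‖f t‖ ^ 2 * Real.exp (-(2 * L) * t)) (Ioo a b) := by
    refine antitoneOn_of_deriv_nonpos (convex_Ioo a b)
      (fun t ht => (hderiv _ t ht).continuousAt.continuousWithinAt)
      (fun t ht => (hderiv _ t (interior_subset ht)).differentiableAt.differentiableWithinAt)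
      fun t ht => ?_
    rw [(hderiv _ t (interior_subset ht)).deriv]
    nlinarith [Real.exp_pos (-(2 * L) * t), (abs_le.1 (habs t)).2]
  have hmono : MonotoneOn (fun t => ‖f t‖ ^ 2 * Real.exp (2 * L * t)) (Ioo a b) := by
    refine monotoneOn_of_deriv_nonneg (convex_Ioo a b)
      (fun t ht => (hderiv _ t ht).continuousAt.continuousWithinAt)
      (fun t ht => (hderiv _ t (interior_subset ht)).differentiableAt.differentiableWithinAt)
      fun t ht => ?_
    rw [(hderiv _ t (interior_subset ht)).deriv]
    nlinarith [Real.exp_pos (2 * L * t), (abs_le.1 (habs t)).1]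
  set c := (a + b) / 2 with hc
  have hcm : c ∈ Ioo a b := ⟨by linarith, by linarith⟩
  refine ⟨‖f c‖ * Real.exp (L * (b - a)), fun t ht => ?_⟩
  refine le_of_sq_le_sq ?_ (by positivity)
  have hexp : (‖f c‖ * Real.exp (L * (b - a))) ^ 2 = ‖f c‖ ^ 2 * Real.exp (2 * L * (b - a)) := by
    rw [mul_pow, ← Real.exp_nat_mul]
    push_cast
    ring_nf
  rw [hexp]
  have key : ∀ u v : ℝ, ‖f t‖ ^ 2 * Real.exp u ≤ ‖f c‖ ^ 2 * Real.exp v →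
      v - u ≤ 2 * L * (b - a) → ‖f t‖ ^ 2 ≤ ‖f c‖ ^ 2 * Real.exp (2 * L * (b - a)) := by
    intro u v huv hle
    have h1 := mul_le_mul_of_nonneg_right huv (Real.exp_pos (-u)).le
    rw [mul_assoc, mul_assoc, ← Real.exp_add, ← Real.exp_add, add_neg_cancel, Real.exp_zero,
      mul_one] at h1
    refine h1.trans ?_
    gcongr
    linarith
  rcases le_total t c with htc | hct
  · refine key _ _ (hmono ht hcm htc) ?_
    nlinarith [ht.1, hcm.2]
  · refine key _ _ (hanti hcm ht hct) ?_
    nlinarith [ht.2, hcm.1]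

/-- A function whose derivative grows at most affinely with it stays bounded on bounded
intervals. -/
theorem LocallyAC.exists_bound_of_norm_deriv_le {T M c : ℝ} {f : ℝ → Vec n} (hT : 0 < T)
    (hM : 0 ≤ M) (hf : LocallyAC (Ico 0 T) f)
    (hf' : ∀ᵐ t : ℝ, t ∈ Ico 0 T → ∃ d, HasDerivAt f d t ∧ ‖d‖ ≤ M * ‖f t‖ + c) :
    ∃ K, ∀ t ∈ Ico 0 T, ‖f t‖ ≤ K := by
  have hsq : LocallyAC (Ico 0 T) (fun t => ‖f t‖ ^ 2) := by
    simpa only [real_inner_self_eq_norm_sq] using hf.inner hf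
  have hanti := (hsq.add (locallyAC_const (c ^ 2))).antitoneOn_mul_exp (k := -(2 * M + 1)) (by
    filter_upwards [hf'] with t ht hI
    obtain ⟨d, hd, hle⟩ := ht hI
    refine ⟨_, (hasDerivAt_norm_sq hd).add_const _, ?_⟩
    have h1 := real_inner_le_norm (f t) d
    have h2 := mul_le_mul_of_nonneg_left hle (norm_nonneg (f t))
    nlinarith [sq_nonneg (‖f t‖ - c), sq_nonneg c])
  refine ⟨√((‖f 0‖ ^ 2 + c ^ 2) * Real.exp ((2 * M + 1) * T)), fun t ht => Real.le_sqrt_of_sq_le ?_⟩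
  have h1 := hanti ⟨le_rfl, hT⟩ ht ht.1
  simp only [mul_zero, Real.exp_zero, mul_one] at h1
  have h2 := mul_le_mul_of_nonneg_right h1 (Real.exp_pos ((2 * M + 1) * t)).le
  rw [mul_assoc, ← Real.exp_add, show -(2 * M + 1) * t + (2 * M + 1) * t = 0 by ring,
    Real.exp_zero, mul_one] at h2
  have h3 : Real.exp ((2 * M + 1) * t) ≤ Real.exp ((2 * M + 1) * T) := by
    gcongr
    exact ht.2.le
  have h4 := mul_le_mul_of_nonneg_left h3 (by positivity : 0 ≤ ‖f 0‖ ^ 2 + c ^ 2)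
  linarith [sq_nonneg c]

end Linear

section Shape

variable {n p q : ℕ} {P : Plant n p q} {K₁ : Matrix (Fin p) (Fin n) ℝ} {h : ℝ → Vec n}

/-- Finitely many jumps do not make a shape signal unbounded on a bounded interval. -/
theorem IsShapeSignal.exists_bound (hh : IsShapeSignal P K₁ h) (T : ℝ) :
    ∃ K, ∀ t ∈ Icc 0 T, ‖h t‖ ≤ K := by
  obtain ⟨J, hJ⟩ := hh
  refine isCompact_Icc.induction_on (p := fun s => ∃ K, ∀ t ∈ s, ‖h t‖ ≤ K) ⟨0, by simp⟩ ?_ ?_ ?_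
  · rintro s u hsu ⟨K, hK⟩
    exact ⟨K, fun t ht => hK t (hsu ht)⟩
  · rintro s u ⟨K, hK⟩ ⟨K', hK'⟩
    refine ⟨max K K', fun t ht => ?_⟩
    rcases ht with ht | ht
    · exact (hK t ht).trans (le_max_left _ _)
    · exact (hK' t ht).trans (le_max_right _ _)
  · intro τ hτ
    have hopen : {t : ℝ | t ∈ J → t = τ} ∈ 𝓝 τ := by
      have : IsOpen ((↑(J.erase τ) : Set ℝ)ᶜ) := (J.erase τ).finite_toSet.isClosed.isOpen_compl
      refine mem_of_superset (this.mem_nhds (by simp)) fun t ht htJ => ?_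
      by_contra hne
      exact ht (by simpa using ⟨htJ, hne⟩)
    obtain ⟨δ, hδ, hball⟩ := Metric.mem_nhds_iff.1 hopen
    have hJ' : ∀ t, |t - τ| < δ → t ≠ τ → t ∉ J := fun t ht hne hmem =>
      hne (hball (by simpa [Real.dist_eq] using ht) hmem)
    obtain ⟨K, hK⟩ := exists_bound_Ioo_of_hasDerivAt (P.A + P.B * K₁) (f := h)
      (a := max 0 (τ - δ)) (b := τ) fun t ht => hJ t (lt_of_le_of_lt (le_max_left _ _) ht.1)
        (hJ' t (by
          have := (max_lt_iff.1 ht.1).2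
          rw [abs_lt]; constructor <;> linarith [ht.2]) ht.2.ne)
    obtain ⟨K', hK'⟩ := exists_bound_Ioo_of_hasDerivAt (P.A + P.B * K₁) (f := h)
      (a := τ) (b := τ + δ) fun t ht => hJ t (lt_of_le_of_lt hτ.1 ht.1)
        (hJ' t (by rw [abs_lt]; constructor <;> linarith [ht.1, ht.2]) ht.1.ne')
    refine ⟨Icc 0 T ∩ Ioo (τ - δ) (τ + δ), inter_mem_nhdsWithin _
      (Ioo_mem_nhds (by linarith) (by linarith)), max (max K K') (max ‖h τ‖ ‖h 0‖), ?_⟩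
    rintro t ⟨ht, hlt⟩
    rcases lt_trichotomy t τ with h1 | h1 | h1
    · rcases ht.1.eq_or_lt with h0 | h0
      · exact h0 ▸ (le_max_right _ _).trans (le_max_right _ _)
      · exact (hK t ⟨max_lt h0 hlt.1, h1⟩).trans ((le_max_left _ _).trans (le_max_left _ _))
    · exact h1 ▸ (le_max_left _ _).trans (le_max_right _ _)
    · exact (hK' t ⟨h1, hlt.2⟩).trans ((le_max_right _ _).trans (le_max_left _ _))

end Shape

/-! ### Matrices acting on Euclidean vectors -/

section Matrices

variable {l m n : ℕ}

theorem matVec_matVec (M : Matrix (Fin l) (Fin m) ℝ) (M' : Matrix (Fin m) (Fin n) ℝ) (x : Vec n) :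
    M *ₑ M' *ₑ x = (M * M') *ₑ x := by
  simp [matVec, Matrix.toLpLin_apply, Matrix.mulVec_mulVec]

theorem add_matVec (M M' : Matrix (Fin m) (Fin n) ℝ) (x : Vec n) :
    (M + M') *ₑ x = M *ₑ x + M' *ₑ x := by
  simp [matVec]

theorem neg_matVec (M : Matrix (Fin m) (Fin n) ℝ) (x : Vec n) :
    (-M) *ₑ x = -(M *ₑ x) := by
  simp [matVec]

theorem matVec_add (M : Matrix (Fin m) (Fin n) ℝ) (x y : Vec n) :
    M *ₑ (x + y) = M *ₑ x + M *ₑ y :=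
  map_add _ _ _

theorem matVec_sub (M : Matrix (Fin m) (Fin n) ℝ) (x y : Vec n) :
    M *ₑ (x - y) = M *ₑ x - M *ₑ y :=
  map_sub _ _ _

theorem matVec_neg (M : Matrix (Fin m) (Fin n) ℝ) (x : Vec n) : M *ₑ (-x) = -(M *ₑ x) :=
  map_neg _ _

theorem matVec_zero (M : Matrix (Fin m) (Fin n) ℝ) : M *ₑ (0 : Vec n) = 0 :=
  map_zero _

theorem matVec_smul (M : Matrix (Fin m) (Fin n) ℝ) (r : ℝ) (x : Vec n) :
    M *ₑ (r • x) = r • (M *ₑ x) :=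
  map_smul _ _ _

theorem inner_matVec (M : Matrix (Fin m) (Fin n) ℝ) (x : Vec m) (y : Vec n) :
    inner ℝ x (M *ₑ y) = inner ℝ (Mᵀ *ₑ x) y := by
  have h := LinearMap.adjoint_inner_left (Matrix.toEuclideanLin M) y x
  rw [← Matrix.toEuclideanLin_conjTranspose_eq_adjoint,
    Matrix.conjTranspose_eq_transpose_of_trivial] at h
  exact h.symm

theorem _root_.Matrix.PosDef.transpose_eq {M : Matrix (Fin n) (Fin n) ℝ} (hM : M.PosDef) :
    Mᵀ = M := by
  rw [← Matrix.conjTranspose_eq_transpose_of_trivial]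
  exact hM.isHermitian

theorem _root_.Matrix.PosDef.inner_matVec_pos {M : Matrix (Fin n) (Fin n) ℝ} (hM : M.PosDef)
    {x : Vec n} (hx : x ≠ 0) : 0 < inner ℝ x (M *ₑ x) := by
  have h := hM.dotProduct_mulVec_pos (x := x.ofLp) (by simpa using hx)
  rw [EuclideanSpace.inner_eq_star_dotProduct, dotProduct_comm]
  simpa [matVec] using h

/-- A positive definite quadratic form is comparable with the squared norm. -/
theorem _root_.Matrix.PosDef.exists_coercive {M : Matrix (Fin n) (Fin n) ℝ} (hM : M.PosDef) :
    ∃ k : ℝ, 0 < k ∧ ∀ x : Vec n, k * ‖x‖ ^ 2 ≤ inner ℝ x (M *ₑ x) := by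
  have hcont : Continuous fun x : Vec n => inner ℝ x (M *ₑ x) :=
    continuous_id.inner (LinearMap.toContinuousLinearMap (Matrix.toEuclideanLin M)).continuous
  rcases (Metric.sphere (0 : Vec n) 1).eq_empty_or_nonempty with he | hne
  · refine ⟨1, one_pos, fun x => ?_⟩
    rcases eq_or_ne x 0 with rfl | hx
    · simp
    · have : ‖x‖⁻¹ • x ∈ Metric.sphere (0 : Vec n) 1 := by
        simp [norm_smul, inv_mul_cancel₀ (norm_ne_zero_iff.2 hx)]
      simp [he] at this
  obtain ⟨y, hy, hmin⟩ := (isCompact_sphere (0 : Vec n) 1).exists_isMinOn hne hcont.continuousOn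
  have hy0 : y ≠ 0 := by
    rintro rfl
    simp at hy
  refine ⟨_, hM.inner_matVec_pos hy0, fun x => ?_⟩
  rcases eq_or_ne x 0 with rfl | hx
  · simp
  have hmem : ‖x‖⁻¹ • x ∈ Metric.sphere (0 : Vec n) 1 := by
    simp [norm_smul, inv_mul_cancel₀ (norm_ne_zero_iff.2 hx)]
  have h := hmin hmem
  simp only [mem_ofPred_eq, map_smul, inner_smul_left, inner_smul_right, conj_trivial] at h
  have hn : 0 < ‖x‖ := norm_pos_iff.2 hx
  have h2 := mul_le_mul_of_nonneg_right h (sq_nonneg ‖x‖)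
  refine h2.trans (le_of_eq ?_)
  field_simp

theorem _root_.Matrix.PosDef.inner_matVec_nonneg {M : Matrix (Fin n) (Fin n) ℝ} (hM : M.PosDef)
    (x : Vec n) : 0 ≤ inner ℝ x (M *ₑ x) := by
  rcases eq_or_ne x 0 with rfl | hx
  · simp
  · exact (hM.inner_matVec_pos hx).le

theorem exists_inner_matVec_bound (M : Matrix (Fin m) (Fin n) ℝ) :
    ∃ K : ℝ, 0 < K ∧ ∀ (x : Vec m) (y : Vec n), inner ℝ x (M *ₑ y) ≤ K * (‖x‖ * ‖y‖) := by
  obtain ⟨K, hK, h⟩ := exists_matVec_bound M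
  refine ⟨K, hK, fun x y => (real_inner_le_norm _ _).trans ?_⟩
  have := mul_le_mul_of_nonneg_left (h y) (norm_nonneg x)
  linarith

/-- The derivative of a symmetric quadratic form along a curve. -/
theorem hasDerivAt_quadraticForm {M : Matrix (Fin n) (Fin n) ℝ} (hM : Mᵀ = M) {f : ℝ → Vec n}
    {f' : Vec n} {t : ℝ} (hf : HasDerivAt f f' t) :
    HasDerivAt (fun t => inner ℝ (f t) (M *ₑ f t)) (2 * inner ℝ (f t) (M *ₑ f')) t := by
  have hM' : HasDerivAt (fun t => M *ₑ f t) (M *ₑ f') t :=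
    (LinearMap.toContinuousLinearMap (Matrix.toEuclideanLin M)).hasFDerivAt.comp_hasDerivAt t hf
  have h := hf.inner ℝ hM'
  rwa [inner_matVec M f' (f t) |>.trans (by rw [hM, real_inner_comm]), ← two_mul] at h

end Matrices

/-! ### Laplacian of a digraph with a spanning tree rooted at the leader -/

section Laplacian

variable {N : ℕ} {a : Matrix (Fin (N + 1)) (Fin (N + 1)) ℝ}
  {E : Type*} [NormedAddCommGroup E] [InnerProductSpace ℝ E]

/-- The Laplacian of the communication graph, applied to one vector per agent and read off at
follower `i`. -/
def lap (a : Matrix (Fin (N + 1)) (Fin (N + 1)) ℝ) {E : Type*} [AddCommGroup E] [Module ℝ E]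
    (y : Fin (N + 1) → E) (i : Fin N) : E :=
  ∑ j, a i.succ j • (y i.succ - y j)

theorem lap_add (y y' : Fin (N + 1) → E) (i : Fin N) :
    lap a (fun j => y j + y' j) i = lap a y i + lap a y' i := by
  simp only [lap, ← Finset.sum_add_distrib, ← smul_add]
  exact Finset.sum_congr rfl fun j _ => by congr 1; abel

theorem lap_sub (y y' : Fin (N + 1) → E) (i : Fin N) :
    lap a (fun j => y j - y' j) i = lap a y i - lap a y' i := by
  simp only [lap, ← Finset.sum_sub_distrib, ← smul_sub]
  exact Finset.sum_congr rfl fun j _ => by congr 1; abel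

theorem lap_matVec {m n : ℕ} (M : Matrix (Fin m) (Fin n) ℝ) (y : Fin (N + 1) → Vec n)
    (i : Fin N) : lap a (fun j => M *ₑ y j) i = M *ₑ lap a y i := by
  simp only [lap, map_sum, map_smul, map_sub]

theorem hasDerivAt_lap {y : Fin (N + 1) → ℝ → E} {y' : Fin (N + 1) → E} {t : ℝ}
    (hy : ∀ j, HasDerivAt (y j) (y' j) t) (i : Fin N) :
    HasDerivAt (fun t => lap a (fun j => y j t) i) (lap a y' i) t := by
  unfold lap
  exact HasDerivAt.fun_sum fun j _ => ((hy i.succ).sub (hy j)).const_smul _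

theorem LocallyAC.lap {I : Set ℝ} {y : Fin (N + 1) → ℝ → E} (hy : ∀ j, LocallyAC I (y j))
    (i : Fin N) : LocallyAC I (fun t => lap a (fun j => y j t) i) :=
  LocallyAC.sum _ fun j _ => ((hy i.succ).sub (hy j)).const_smul _

/-- Discrete maximum principle: since every follower is reached from the leader, a function that
vanishes at the leader and has nonnegative Laplacian is nonnegative. -/
theorem nonneg_of_lap_nonneg (ha : ∀ i j, 0 ≤ a i j) (htree : HasSpanningTreeFrom a 0)
    {y : Fin (N + 1) → ℝ} (h0 : y 0 = 0) (hy : ∀ i, 0 ≤ lap a y i) (j : Fin (N + 1)) :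
    0 ≤ y j := by
  obtain ⟨m, -, hm⟩ := Finset.exists_min_image Finset.univ y ⟨0, Finset.mem_univ _⟩
  replace hm : ∀ j, y m ≤ y j := fun j => hm j (Finset.mem_univ _)
  by_contra! hneg
  have hm0 : y m < y 0 := h0 ▸ (hm j).trans_lt hneg
  -- Along a path from the leader, the minimum is never attained.
  have hpath : ∀ i, Relation.ReflTransGen (fun j k => 0 < a k j) 0 i → y m < y i := by
    intro i hi
    induction hi with
    | refl => exact hm0
    | @tail b c _ hbc ih =>
      refine lt_of_le_of_ne (hm c) fun hc => ?_
      obtain ⟨i, rfl⟩ : ∃ i : Fin N, i.succ = c := Fin.exists_succ_eq.2 (by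
        rintro rfl
        exact hm0.ne hc)
      refine (hy i).not_gt (Finset.sum_neg' (fun k _ => ?_) ⟨b, Finset.mem_univ _, ?_⟩)
      · exact mul_nonpos_of_nonneg_of_nonpos (ha _ _) (by linarith [hm k])
      · exact mul_neg_of_pos_of_neg hbc (by linarith)
  exact (hpath m (htree m)).false

/-- The block of the Laplacian that belongs to the followers. -/
def lapMatrix (a : Matrix (Fin (N + 1)) (Fin (N + 1)) ℝ) : Matrix (Fin N) (Fin N) ℝ :=
  Matrix.of fun i k => (if i = k then ∑ j, a i.succ j else 0) - a i.succ k.succ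

theorem lap_eq_sum (y : Fin (N + 1) → E) (i : Fin N) :
    lap a y i = ∑ k, lapMatrix a i k • y k.succ - a i.succ 0 • y 0 := by
  simp only [lap, lapMatrix, Matrix.of_apply, sub_smul, ite_smul, zero_smul, smul_sub,
    Finset.sum_sub_distrib, Finset.sum_ite_eq, Finset.mem_univ, if_true, ← Finset.sum_smul]
  rw [Fin.sum_univ_succ (fun j => a i.succ j • y j)]
  abel

theorem lapMatrix_mulVec (y : Fin N → ℝ) (i : Fin N) :
    (lapMatrix a *ᵥ y) i = lap a (Fin.cons 0 y : Fin (N + 1) → ℝ) i := by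
  simp [lap_eq_sum, Matrix.mulVec, dotProduct]

/-- The follower block of the Laplacian has positive vectors `r`, `l` with `L r = 1` and
`lᵀ L = 1`. -/
theorem exists_pos_vectors (ha : ∀ i j, 0 ≤ a i j) (htree : HasSpanningTreeFrom a 0) :
    ∃ r l : Fin N → ℝ, (∀ i, 0 < r i) ∧ (∀ i, 0 < l i) ∧
      (∀ i, ∑ k, lapMatrix a i k * r k = 1) ∧ ∀ k, ∑ i, l i * lapMatrix a i k = 1 := by
  have hmax : ∀ y : Fin N → ℝ, (∀ i, 0 ≤ (lapMatrix a *ᵥ y) i) → ∀ i, 0 ≤ y i := fun y hy i => by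
    simpa using nonneg_of_lap_nonneg ha htree (y := (Fin.cons 0 y : Fin (N + 1) → ℝ)) rfl
      (fun i => by simpa [lapMatrix_mulVec] using hy i) i.succ
  have hunit : IsUnit (lapMatrix a) := by
    rw [← Matrix.mulVec_injective_iff_isUnit]
    intro y y' hyy'
    ext i
    have h1 := hmax (y - y') (fun i => by simp [Matrix.mulVec_sub, hyy']) i
    have h2 := hmax (y' - y) (fun i => by simp [Matrix.mulVec_sub, hyy']) i
    simp only [Pi.sub_apply] at h1 h2
    linarith
  have hdet := (Matrix.isUnit_iff_isUnit_det _).1 hunit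
  set Li := (lapMatrix a)⁻¹ with hLi
  have hmul : lapMatrix a * Li = 1 := Matrix.mul_nonsing_inv _ hdet
  have hmul' : Li * lapMatrix a = 1 := Matrix.nonsing_inv_mul _ hdet
  have hnn : ∀ i k, 0 ≤ Li i k := fun i k =>
    hmax (fun i => Li i k) (fun j => by
      have : (lapMatrix a *ᵥ fun i => Li i k) j = (lapMatrix a * Li) j k := rfl
      rw [this, hmul, Matrix.one_apply]
      split_ifs <;> norm_num) i
  refine ⟨fun i => ∑ k, Li i k, fun k => ∑ i, Li i k, fun i => ?_, fun k => ?_, fun i => ?_,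
    fun k => ?_⟩
  · refine (Finset.sum_nonneg fun k _ => hnn i k).lt_of_ne fun h0 => ?_
    have hz := (Finset.sum_eq_zero_iff_of_nonneg fun k _ => hnn i k).1 h0.symm
    have h1 : (Li * lapMatrix a) i i = 1 := by rw [hmul', Matrix.one_apply_eq]
    rw [Matrix.mul_apply, Finset.sum_eq_zero fun k hk => by rw [hz k hk, zero_mul]] at h1
    exact zero_ne_one h1
  · refine (Finset.sum_nonneg fun i _ => hnn i k).lt_of_ne fun h0 => ?_
    have hz := (Finset.sum_eq_zero_iff_of_nonneg fun i _ => hnn i k).1 h0.symm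
    have h1 : (lapMatrix a * Li) k k = 1 := by rw [hmul, Matrix.one_apply_eq]
    rw [Matrix.mul_apply, Finset.sum_eq_zero fun i hi => by rw [hz i hi, mul_zero]] at h1
    exact zero_ne_one h1
  · simp only [Finset.mul_sum]
    rw [Finset.sum_comm]
    simp only [← Matrix.mul_apply, hmul, Matrix.one_apply]
    simp
  · simp only [Finset.sum_mul]
    rw [Finset.sum_comm]
    simp only [← Matrix.mul_apply, hmul', Matrix.one_apply]
    simp

/-- The scaled follower block `G L + Lᵀ G` is positive definite, which gives a coercivity estimate
for the Laplacian up to the value at the leader. -/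
theorem exists_lap_coercive (ha : ∀ i j, 0 ≤ a i j) (htree : HasSpanningTreeFrom a 0) :
    ∃ (g : Fin N → ℝ) (c K : ℝ), (∀ i, 0 < g i) ∧ 0 < c ∧ 0 ≤ K ∧
      ∀ {E : Type} [NormedAddCommGroup E] [InnerProductSpace ℝ E] (y : Fin (N + 1) → E),
        c * ∑ i : Fin N, ‖y i.succ‖ ^ 2 - K * ‖y 0‖ ^ 2 ≤
          ∑ i, g i * inner ℝ (y i.succ) (lap a y i) := by
  obtain ⟨r, l, hr, hl, hLr, hlL⟩ := exists_pos_vectors ha htree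
  set R := ∑ i, r i with hR
  have hR0 : 0 ≤ R := Finset.sum_nonneg fun i _ => (hr i).le
  have hrR : ∀ i, r i ≤ R := fun i =>
    Finset.single_le_sum (fun i _ => (hr i).le) (Finset.mem_univ i)
  refine ⟨fun i => l i / r i, (4 * (R + 1))⁻¹, ∑ i, (l i / r i * a i.succ 0) ^ 2 * r i,
    fun i => div_pos (hl i) (hr i), by positivity,
    Finset.sum_nonneg fun i _ => mul_nonneg (sq_nonneg _) (hr i).le, ?_⟩
  intro E _ _ y
  -- In the coordinates `y i / r i` the symmetrized matrix is diagonally dominant.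
  have hentry : ∀ i k, l i / r i * lapMatrix a i k *
      (1 / 2 * (r k / r i * ‖y i.succ‖ ^ 2 + r i / r k * ‖y k.succ‖ ^ 2)) ≤
      l i / r i * lapMatrix a i k * inner ℝ (y i.succ) (y k.succ) := by
    intro i k
    have hi := hr i
    have hk := hr k
    rcases eq_or_ne i k with rfl | hik
    · rw [div_self hi.ne', real_inner_self_eq_norm_sq]
      exact le_of_eq (by ring)
    · refine mul_le_mul_of_nonpos_left ?_ (mul_nonpos_of_nonneg_of_nonpos
        (div_pos (hl i) hi).le (by simp [lapMatrix, hik, ha]))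
      refine (real_inner_le_norm _ _).trans ?_
      have h1 : r k / r i * ‖y i.succ‖ ^ 2 + r i / r k * ‖y k.succ‖ ^ 2
          - 2 * (‖y i.succ‖ * ‖y k.succ‖)
          = (r k * ‖y i.succ‖ - r i * ‖y k.succ‖) ^ 2 / (r i * r k) := by
        field_simp
        ring
      have h2 : 0 ≤ (r k * ‖y i.succ‖ - r i * ‖y k.succ‖) ^ 2 / (r i * r k) := by positivity
      linarith
  have hsum : ∑ i, (2 * r i)⁻¹ * ‖y i.succ‖ ^ 2 ≤
      ∑ i, ∑ k, l i / r i * lapMatrix a i k * inner ℝ (y i.succ) (y k.succ) := by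
    refine le_trans ?_ (Finset.sum_le_sum fun i _ => Finset.sum_le_sum fun k _ => hentry i k)
    have hsplit : ∀ i k, l i / r i * lapMatrix a i k *
        (1 / 2 * (r k / r i * ‖y i.succ‖ ^ 2 + r i / r k * ‖y k.succ‖ ^ 2)) =
        l i / (2 * r i ^ 2) * ‖y i.succ‖ ^ 2 * (lapMatrix a i k * r k) +
        (2 * r k)⁻¹ * ‖y k.succ‖ ^ 2 * (l i * lapMatrix a i k) := by
      intro i k
      have hi := (hr i).ne'
      have hk := (hr k).ne'
      field_simp
    simp only [hsplit, Finset.sum_add_distrib, ← Finset.mul_sum, hLr, mul_one]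
    rw [Finset.sum_comm (f := fun i k => (2 * r k)⁻¹ * ‖y k.succ‖ ^ 2 * (l i * lapMatrix a i k))]
    simp only [← Finset.mul_sum, hlL, mul_one]
    exact le_add_of_nonneg_left (Finset.sum_nonneg fun i _ =>
      mul_nonneg (div_nonneg (hl i).le (by positivity)) (sq_nonneg _))
  have hexp : ∑ i, l i / r i * inner ℝ (y i.succ) (lap a y i) =
      ∑ i, ∑ k, l i / r i * lapMatrix a i k * inner ℝ (y i.succ) (y k.succ) -
      ∑ i, l i / r i * a i.succ 0 * inner ℝ (y i.succ) (y 0) := by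
    simp only [lap_eq_sum, inner_sub_right, inner_sum, inner_smul_right, mul_sub, Finset.mul_sum,
      Finset.sum_sub_distrib, mul_assoc]
  have hlead : ∑ i, l i / r i * a i.succ 0 * inner ℝ (y i.succ) (y 0) ≤
      ∑ i, ((4 * r i)⁻¹ * ‖y i.succ‖ ^ 2 + (l i / r i * a i.succ 0) ^ 2 * r i * ‖y 0‖ ^ 2) := by
    refine Finset.sum_le_sum fun i _ => ?_
    have hi := hr i
    set b := l i / r i * a i.succ 0
    have hb : 0 ≤ b := mul_nonneg (div_pos (hl i) hi).le (ha _ _)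
    have h1 := mul_le_mul_of_nonneg_left (real_inner_le_norm (y i.succ) (y 0)) hb
    have h2 : (4 * r i)⁻¹ * ‖y i.succ‖ ^ 2 + b ^ 2 * r i * ‖y 0‖ ^ 2
        - b * (‖y i.succ‖ * ‖y 0‖) = (‖y i.succ‖ - 2 * r i * b * ‖y 0‖) ^ 2 / (4 * r i) := by
      field_simp
      ring
    have h3 : 0 ≤ (‖y i.succ‖ - 2 * r i * b * ‖y 0‖) ^ 2 / (4 * r i) := by positivity
    linarith
  have hc : (4 * (R + 1))⁻¹ * ∑ i : Fin N, ‖y i.succ‖ ^ 2 ≤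
      ∑ i, (4 * r i)⁻¹ * ‖y i.succ‖ ^ 2 := by
    rw [Finset.mul_sum]
    refine Finset.sum_le_sum fun i _ => mul_le_mul_of_nonneg_right ?_ (sq_nonneg _)
    have hi := hr i
    exact inv_anti₀ (by positivity) (by linarith [hrR i])
  have hhalf : ∑ i, (2 * r i)⁻¹ * ‖y i.succ‖ ^ 2 = ∑ i, (4 * r i)⁻¹ * ‖y i.succ‖ ^ 2 +
      ∑ i, (4 * r i)⁻¹ * ‖y i.succ‖ ^ 2 := by
    rw [← Finset.sum_add_distrib]
    refine Finset.sum_congr rfl fun i _ => ?_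
    rw [mul_inv, mul_inv]
    ring
  rw [hexp]
  rw [Finset.sum_add_distrib, ← Finset.sum_mul] at hlead
  linarith

/-- The deviations from the leader are controlled by the Laplacian. -/
theorem exists_norm_sub_le_lap (ha : ∀ i j, 0 ≤ a i j) (htree : HasSpanningTreeFrom a 0) :
    ∃ K : ℝ, 0 ≤ K ∧ ∀ {E : Type} [NormedAddCommGroup E] [InnerProductSpace ℝ E]
      (y : Fin (N + 1) → E) (i : Fin N), ‖y i.succ - y 0‖ ^ 2 ≤ K * ∑ k, ‖lap a y k‖ ^ 2 := by
  obtain ⟨g, c, K, hg, hc, hK, h⟩ := exists_lap_coercive ha htree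
  refine ⟨∑ i, (g i / c) ^ 2, Finset.sum_nonneg fun i _ => sq_nonneg _, ?_⟩
  intro E _ _ y i
  have h1 := h (fun j => y j - y 0)
  have hlap : ∀ i, lap a (fun j => y j - y 0) i = lap a y i := fun i => by simp [lap]
  simp only [hlap, sub_self, norm_zero, ne_eq, OfNat.ofNat_ne_zero, not_false_eq_true, zero_pow,
    mul_zero, sub_zero] at h1
  have h2 : ∑ i, g i * inner ℝ (y i.succ - y 0) (lap a y i) ≤
      c / 2 * ∑ i : Fin N, ‖y i.succ - y 0‖ ^ 2 + c / 2 * ∑ i, (g i / c) ^ 2 * ‖lap a y i‖ ^ 2 := by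
    rw [Finset.mul_sum, Finset.mul_sum, ← Finset.sum_add_distrib]
    refine Finset.sum_le_sum fun i _ => ?_
    have h3 := mul_le_mul_of_nonneg_left (real_inner_le_norm (y i.succ - y 0) (lap a y i))
      (hg i).le
    have h4 : c / 2 * ‖y i.succ - y 0‖ ^ 2 + c / 2 * ((g i / c) ^ 2 * ‖lap a y i‖ ^ 2)
        - g i * (‖y i.succ - y 0‖ * ‖lap a y i‖)
        = c / 2 * (‖y i.succ - y 0‖ - g i / c * ‖lap a y i‖) ^ 2 := by
      field_simp
      ring
    have h5 : 0 ≤ c / 2 * (‖y i.succ - y 0‖ - g i / c * ‖lap a y i‖) ^ 2 := by positivity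
    linarith
  have h6 : ∑ i, (g i / c) ^ 2 * ‖lap a y i‖ ^ 2 ≤
      (∑ i, (g i / c) ^ 2) * ∑ k, ‖lap a y k‖ ^ 2 := by
    rw [Finset.sum_mul]
    exact Finset.sum_le_sum fun i _ => mul_le_mul_of_nonneg_left
      (Finset.single_le_sum (f := fun k => ‖lap a y k‖ ^ 2) (fun k _ => sq_nonneg _)
        (Finset.mem_univ i)) (sq_nonneg _)
  have h7 := Finset.single_le_sum (f := fun i : Fin N => ‖y i.succ - y 0‖ ^ 2)
    (fun k _ => sq_nonneg _) (Finset.mem_univ i)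
  have h8 : c / 2 * ∑ i : Fin N, ‖y i.succ - y 0‖ ^ 2 ≤
      c / 2 * ∑ i, (g i / c) ^ 2 * ‖lap a y i‖ ^ 2 := by linarith
  have h9 := le_of_mul_le_mul_left h8 (half_pos hc)
  linarith

/-- The unit vector feedback `d_i = -β ζ` with `⟨b, ζ⟩ = ‖b‖` dominates inputs of norm at most `β` at
the neighbours: each term `⟨b, d_i - d_j⟩` of the Laplacian is nonpositive. -/
theorem inner_lap_nonpos (ha : ∀ i j, 0 ≤ a i j) {d : Fin (N + 1) → E} {i : Fin N} {b : E} {β : ℝ}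
    (hdi : inner ℝ b (d i.succ) = -(β * ‖b‖)) (hd : ∀ j, ‖d j‖ ≤ β) :
    inner ℝ b (lap a d i) ≤ 0 := by
  simp only [lap, inner_sum, inner_smul_right]
  refine Finset.sum_nonpos fun j _ => mul_nonpos_of_nonneg_of_nonpos (ha _ _) ?_
  rw [inner_sub_right, hdi]
  have h1 := neg_le_of_abs_le (abs_real_inner_le_norm b (d j))
  have h2 := mul_le_mul_of_nonneg_left (hd j) (norm_nonneg b)
  linarith

theorem exists_norm_lap_le {n : ℕ} (a : Matrix (Fin (N + 1)) (Fin (N + 1)) ℝ) :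
    ∃ K : ℝ, 0 ≤ K ∧ ∀ (y : Fin (N + 1) → Vec n) (i : Fin N) (c : ℝ),
      (∀ j, ‖y j‖ ≤ c) → ‖lap a y i‖ ≤ K * c := by
  refine ⟨∑ i : Fin N, ∑ j, |a i.succ j| * 2, by positivity, fun y i c hy => ?_⟩
  have hc : 0 ≤ c := (norm_nonneg _).trans (hy 0)
  refine (norm_sum_le _ _).trans ?_
  refine le_trans ?_ (mul_le_mul_of_nonneg_right (Finset.single_le_sum
    (f := fun i : Fin N => ∑ j, |a i.succ j| * 2) (fun i _ => by positivity)
    (Finset.mem_univ i)) hc)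
  rw [Finset.sum_mul]
  refine Finset.sum_le_sum fun j _ => ?_
  rw [norm_smul, Real.norm_eq_abs, mul_assoc]
  refine mul_le_mul_of_nonneg_left ((norm_sub_le _ _).trans ?_) (abs_nonneg _)
  linarith [hy i.succ, hy j]

end Laplacian

section UnitField

variable {p : ℕ} {x ζ : Vec p}

theorem norm_le_one_of_mem_zSet (hζ : ζ ∈ zSet x) : ‖ζ‖ ≤ 1 := by
  by_cases hx : x = 0
  · simpa [zSet, hx] using hζ
  · have h : ‖x‖ ≠ 0 := norm_ne_zero_iff.2 hx
    simp only [zSet, if_neg hx, mem_singleton_iff] at hζ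
    rw [hζ, z, if_neg h, norm_smul, norm_inv, norm_norm, inv_mul_cancel₀ h]

theorem inner_eq_norm_of_mem_zSet (hζ : ζ ∈ zSet x) : inner ℝ x ζ = ‖x‖ := by
  by_cases hx : x = 0
  · simp [hx]
  · have h : ‖x‖ ≠ 0 := norm_ne_zero_iff.2 hx
    simp only [zSet, if_neg hx, mem_singleton_iff] at hζ
    rw [hζ, z, if_neg h, inner_smul_right, real_inner_self_eq_norm_sq]
    field_simp

end UnitField

/-! ### Lyapunov inequalities -/

section Lyapunov

variable {n p q : ℕ}

theorem inner_lyapunov {M A : Matrix (Fin n) (Fin n) ℝ} (hM : Mᵀ = M) (x : Vec n) :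
    inner ℝ x ((-(M * A + Aᵀ * M)) *ₑ x) = -(2 * inner ℝ x (M *ₑ A *ₑ x)) := by
  have h : inner ℝ x (Aᵀ *ₑ M *ₑ x) = inner ℝ x (M *ₑ A *ₑ x) := by
    rw [inner_matVec, Matrix.transpose_transpose, real_inner_comm, ← hM, ← inner_matVec, hM]
  rw [neg_matVec, add_matVec, ← matVec_matVec, ← matVec_matVec, inner_neg_right, inner_add_right, h,
    two_mul]

/-- Along a switched signal, the observer error `e = y + g` satisfies the stable equation
`ė = M e` between the jumps; it is bounded, and it tends to `0` if time is unbounded. -/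
theorem observerError_bound {P : Plant n p q} {K₁ : Matrix (Fin p) (Fin n) ℝ}
    {Q M : Matrix (Fin n) (Fin n) ℝ} (hQ : Q.PosDef) (hW : (-(Q * M + Mᵀ * Q)).PosDef)
    {I : Set ℝ} (hI : IsTimeInterval I) {y g : ℝ → Vec n} (hg : IsShapeSignal P K₁ g)
    (hy : LocallyAC I y)
    (hy' : ∀ᵐ t : ℝ, t ∈ I →
      HasDerivAt y (M *ₑ (y t + g t) - (P.A + P.B * K₁) *ₑ g t) t) :
    (∃ K, ∀ t ∈ I, ‖y t + g t‖ ≤ K) ∧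
      (I = Ici 0 → Tendsto (fun t => y t + g t) atTop (𝓝 0)) := by
  obtain ⟨J, hJ⟩ := id hg
  obtain ⟨τ, hτI, hτ0, hτ⟩ := hI.exists_forall_notMem J
  obtain ⟨w, hw, hwW⟩ := hW.exists_coercive
  obtain ⟨m, hm, hmQ⟩ := hQ.exists_coercive
  obtain ⟨κ, hκ, hκQ⟩ := exists_inner_matVec_bound Q
  have hκQ' : ∀ x : Vec n, inner ℝ x (Q *ₑ x) ≤ κ * ‖x‖ ^ 2 := fun x => by
    simpa [sq] using hκQ x x
  have hord := hI.inter_Ici τ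
  have hgd : ∀ t ∈ I ∩ Ici τ, HasDerivAt g ((P.A + P.B * K₁) *ₑ g t) t := fun t ht =>
    hJ t (hτ0.trans_le ht.2) (hτ t ht.1 ht.2)
  have hgac : LocallyAC (I ∩ Ici τ) g := by
    intro s hs t ht
    obtain ⟨B, hB⟩ := hg.exists_bound (max s t)
    obtain ⟨L, hL, hLb⟩ := exists_matVec_bound (P.A + P.B * K₁)
    have hsub := hord.uIcc_subset hs ht
    refine locallyAC_of_hasDerivAt (I := uIcc s t) (fun r hr => hgd r (hsub hr)) (K := L * B)
      (fun r hr => (hLb _).trans (mul_le_mul_of_nonneg_left (hB r ?_) hL.le))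
      s left_mem_uIcc t right_mem_uIcc
    exact ⟨hτ0.le.trans (hsub hr).2, hr.2⟩
  have heac : LocallyAC (I ∩ Ici τ) (fun t => y t + g t) := (hy.mono inter_subset_left).add hgac
  have hanti := (heac.inner (heac.matVec Q)).antitoneOn_mul_exp (k := w / κ) (by
    filter_upwards [hy'] with t ht htI
    have he := (ht htI.1).add (hgd t htI)
    rw [sub_add_cancel] at he
    refine ⟨_, hasDerivAt_quadraticForm hQ.transpose_eq he, ?_⟩
    have h1 := inner_lyapunov (A := M) hQ.transpose_eq (y t + g t)
    have h2 := hwW (y t + g t)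
    have h3 := mul_le_mul_of_nonneg_left (hκQ' (y t + g t)) (div_pos hw hκ).le
    have h4 : w / κ * (κ * ‖y t + g t‖ ^ 2) = w * ‖y t + g t‖ ^ 2 := by
      field_simp
    linarith)
  set V₀ := inner ℝ (y τ + g τ) (Q *ₑ (y τ + g τ)) * Real.exp (w / κ * τ) with hV₀
  have hV₀0 : 0 ≤ V₀ := mul_nonneg (hQ.inner_matVec_nonneg _) (Real.exp_pos _).le
  have hdecay : ∀ t ∈ I ∩ Ici τ, ‖y t + g t‖ ^ 2 ≤ V₀ / m * Real.exp (-(w / κ * t)) := by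
    intro t ht
    have h1 := mul_le_mul_of_nonneg_right (hanti ⟨hτI, self_mem_Ici⟩ ht ht.2)
      (Real.exp_pos (-(w / κ * t))).le
    simp only at h1
    rw [mul_assoc, ← Real.exp_add, add_neg_cancel, Real.exp_zero, mul_one] at h1
    rw [div_mul_eq_mul_div, le_div_iff₀ hm]
    linarith [hmQ (y t + g t)]
  refine ⟨?_, fun hI0 => ?_⟩
  · obtain ⟨Kg, hKg⟩ := hg.exists_bound τ
    obtain ⟨Ky, hKy⟩ := isCompact_Icc.exists_bound_of_continuousOn
      (hy.continuousOn hI.zero_mem hτI hτ0.le)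
    refine ⟨max (Ky + Kg) (√(V₀ / m)), fun t ht => ?_⟩
    rcases le_total t τ with h | h
    · exact le_max_of_le_left ((norm_add_le _ _).trans
        (add_le_add (hKy t ⟨hI.nonneg t ht, h⟩) (hKg t ⟨hI.nonneg t ht, h⟩)))
    · refine le_max_of_le_right (Real.le_sqrt_of_sq_le ((hdecay t ⟨ht, h⟩).trans ?_))
      refine mul_le_of_le_one_right (by positivity) (Real.exp_le_one_iff.2 ?_)
      have := hI.nonneg t ht
      have : 0 ≤ w / κ * t := by positivity
      linarith
  · rw [tendsto_zero_iff_norm_tendsto_zero]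
    have hlim : Tendsto (fun t => V₀ / m * Real.exp (-(w / κ * t))) atTop (𝓝 0) := by
      rw [← mul_zero (V₀ / m)]
      exact (Real.tendsto_exp_neg_atTop_nhds_zero.comp
        (tendsto_id.const_mul_atTop (div_pos hw hκ))).const_mul _
    have hsq : Tendsto (fun t => ‖y t + g t‖ ^ 2) atTop (𝓝 0) := by
      refine squeeze_zero' (Eventually.of_forall fun t => sq_nonneg _) ?_ hlim
      filter_upwards [eventually_ge_atTop τ] with t ht
      exact hdecay t ⟨hI0 ▸ hτ0.le.trans ht, ht⟩
    simpa [Real.sqrt_sq] using hsq.sqrt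

end Lyapunov

/-! ### Error equations of the closed loop -/

section ErrorEquations

variable {N n p q : ℕ} {P : Plant n p q} {G : Gains n p q}
  {a : Matrix (Fin (N + 1)) (Fin (N + 1)) ℝ} {h : Fin N → ℝ → Vec n} {u₀ : ℝ → Vec p}
  {I : Set ℝ} {X : Histories N n}

/-- The shape signals of all agents; the leader's is zero. -/
def shape (h : Fin N → ℝ → Vec n) : Fin (N + 1) → ℝ → Vec n :=
  Fin.cons (fun _ => 0) h

/-- The error of the local observer of agent `j`, which estimates `x_j - h_j`. -/
def obsErr (X : Histories N n) (h : Fin N → ℝ → Vec n) (j : Fin (N + 1)) (t : ℝ) : Vec n :=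
  X.w j t - X.x j t + shape h j t

theorem obsErr_zero (t : ℝ) : obsErr X h 0 t = X.w 0 t - X.x 0 t := by
  simp [obsErr, shape]

theorem obsErr_succ (i : Fin N) (t : ℝ) :
    obsErr X h i.succ t = X.w i.succ t - X.x i.succ t + h i t := by
  simp [obsErr, shape]

theorem isShapeSignal_shape (hh : ∀ i, IsShapeSignal P G.K₁ (h i)) (j : Fin (N + 1)) :
    IsShapeSignal P G.K₁ (shape h j) := by
  refine Fin.cases ⟨∅, fun t _ _ => ?_⟩ (fun i => ?_) j
  · simpa [shape] using hasDerivAt_const t (0 : Vec n)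
  · simpa [shape] using hh i

theorem ϱ_eq_lap (i : Fin N) (t : ℝ) :
    X.ϱ a i t = lap a (fun j => X.v j t - X.w j t) i := by
  rw [lap_sub]
  rfl

/-- The equations at time `t`, with the values `ζ₁`, `ζ₂` of the regularized unit vector field, and
with the derivative of the leader's trivial distributed observer. -/
structure ClosedLoopAt (P : Plant n p q) (G : Gains n p q)
    (a : Matrix (Fin (N + 1)) (Fin (N + 1)) ℝ) (h : Fin N → ℝ → Vec n) (u₀ : ℝ → Vec p)
    (X : Histories N n) (t : ℝ) (ζ₁ ζ₂ : Fin N → Vec p) : Prop where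
  pos : 0 < t
  leader : LeaderEquations P G u₀ X t
  leader_v : X.v 0 t = 0
  leader_deriv_v : HasDerivAt (X.v 0) 0 t
  mem₁ : ∀ i, ζ₁ i ∈ zSet (P.Bᵀ *ₑ G.S *ₑ X.η a i t)
  mem₂ : ∀ i, ζ₂ i ∈ zSet (P.Bᵀ *ₑ G.Q *ₑ X.ϱ a i t)
  follower : ∀ i, FollowerEquations P G a h X i (ζ₁ i) (ζ₂ i) t

theorem IsClosedLoopSolution.ae_closedLoopAt (hI : IsTimeInterval I)
    (hX : IsClosedLoopSolution P G a h u₀ I X) :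
    ∀ᵐ t : ℝ, t ∈ I → ∃ ζ₁ ζ₂, ClosedLoopAt P G a h u₀ X t ζ₁ ζ₂ := by
  have hne : ∀ᵐ t : ℝ, t ≠ 0 := by simp [ae_iff, measure_singleton]
  filter_upwards [hX.leader, hX.followers, hne] with t hl hf h0 ht
  have hpos : 0 < t := lt_of_le_of_ne (hI.nonneg t ht) h0.symm
  choose ζ₁ h₁ ζ₂ h₂ hf using hf ht
  refine ⟨ζ₁, ζ₂, hpos, hl ht, hX.leader_v t ht, ?_, h₁, h₂, hf⟩
  refine (hasDerivAt_const t (0 : Vec n)).congr_of_eventuallyEq ?_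
  filter_upwards [hI.mem_nhds ht hpos] with s hs using hX.leader_v s hs

namespace ClosedLoopAt

variable {t : ℝ} {ζ₁ ζ₂ : Fin N → Vec p}

theorem hasDerivAt_c (H : ClosedLoopAt P G a h u₀ X t ζ₁ ζ₂) (hΓ : G.Γ = 1) (i : Fin N) :
    HasDerivAt (X.c i) (‖P.C *ₑ X.ϱ a i t‖ ^ 2) t := by
  have hc := (H.follower i).2.2.2
  rw [hΓ] at hc
  have h1 : ∀ x : Vec q, (1 : Matrix (Fin q) (Fin q) ℝ) *ₑ x = x := fun x => by simp [matVec]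
  rwa [h1, real_inner_self_eq_norm_sq] at hc

theorem hasDerivAt_w_sub_x (H : ClosedLoopAt P G a h u₀ X t ζ₁ ζ₂) (j : Fin (N + 1)) :
    HasDerivAt (fun t => X.w j t - X.x j t)
      ((P.A + G.F * P.C) *ₑ (X.w j t - X.x j t + shape h j t)
        - (P.A + P.B * G.K₁) *ₑ shape h j t) t := by
  refine Fin.cases ?_ (fun i => ?_) j
  · refine (H.leader.2.fun_sub H.leader.1).congr_deriv ?_
    simp only [shape, Fin.cons_zero, add_matVec, ← matVec_matVec, matVec_sub, matVec_add,
      matVec_zero]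
    abel
  · obtain ⟨hx, hw, -, -⟩ := H.follower i
    refine (hw.fun_sub hx).congr_deriv ?_
    simp only [shape, Fin.cons_succ, add_matVec, ← matVec_matVec, matVec_sub, matVec_add]
    abel

theorem hasDerivAt_w (H : ClosedLoopAt P G a h u₀ X t ζ₁ ζ₂) (j : Fin (N + 1)) :
    HasDerivAt (X.w j) (P.A *ₑ X.w j t + (P.B * G.K₂) *ₑ X.v j t
      + P.B *ₑ (Fin.cons (u₀ t) (fun i => -(G.β • ζ₁ i)) : Fin (N + 1) → Vec p) j
      + (G.F * P.C) *ₑ obsErr X h j t) t := by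
  refine Fin.cases ?_ (fun i => ?_) j
  · refine H.leader.2.congr_deriv ?_
    simp only [obsErr_zero, Fin.cons_zero, H.leader_v, ← matVec_matVec, matVec_sub, matVec_zero]
    abel
  · obtain ⟨-, hw, -, -⟩ := H.follower i
    refine hw.congr_deriv ?_
    simp only [obsErr_succ, Fin.cons_succ, ← matVec_matVec, matVec_sub, matVec_add, matVec_neg]
    abel

theorem hasDerivAt_v_sub_w (H : ClosedLoopAt P G a h u₀ X t ζ₁ ζ₂) (j : Fin (N + 1)) :
    HasDerivAt (fun t => X.v j t - X.w j t) (P.A *ₑ (X.v j t - X.w j t)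
      + P.B *ₑ (Fin.cons (-u₀ t) (fun i => -(G.β • ζ₂ i)) : Fin (N + 1) → Vec p) j
      + G.F *ₑ (Fin.cons (-(P.C *ₑ obsErr X h 0 t))
          (fun i => (X.c i t + X.ρ a G.Q i t) • (P.C *ₑ X.ϱ a i t)) :
            Fin (N + 1) → Vec q) j) t := by
  refine Fin.cases ?_ (fun i => ?_) j
  · refine (H.leader_deriv_v.fun_sub H.leader.2).congr_deriv ?_
    simp only [obsErr_zero, Fin.cons_zero, H.leader_v, matVec_sub, matVec_zero, matVec_neg]
    abel
  · obtain ⟨-, hw, hv, -⟩ := H.follower i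
    refine (hv.fun_sub hw).congr_deriv ?_
    simp only [Fin.cons_succ, matVec_sub, matVec_add, matVec_neg, matVec_smul]
    abel

theorem hasDerivAt_η (H : ClosedLoopAt P G a h u₀ X t ζ₁ ζ₂) (i : Fin N) :
    HasDerivAt (X.η a i) ((P.A + P.B * G.K₂) *ₑ X.η a i t + (P.B * G.K₂) *ₑ X.ϱ a i t
      + P.B *ₑ lap a (Fin.cons (u₀ t) (fun i => -(G.β • ζ₁ i)) : Fin (N + 1) → Vec p) i
      + (G.F * P.C) *ₑ lap a (fun j => obsErr X h j t) i) t := by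
  have h1 := hasDerivAt_lap (a := a) H.hasDerivAt_w i
  rw [lap_add, lap_add, lap_add, lap_matVec, lap_matVec, lap_matVec, lap_matVec] at h1
  have h2 : lap a (fun j => X.v j t) i = X.ϱ a i t + X.η a i t := (sub_add_cancel _ _).symm
  refine h1.congr_deriv ?_
  rw [h2, add_matVec, matVec_add]
  change P.A *ₑ X.η a i t + _ + _ + _ = _
  abel

theorem hasDerivAt_ϱ (H : ClosedLoopAt P G a h u₀ X t ζ₁ ζ₂) (i : Fin N) :
    HasDerivAt (X.ϱ a i) (P.A *ₑ X.ϱ a i t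
      + P.B *ₑ lap a (Fin.cons (-u₀ t) (fun i => -(G.β • ζ₂ i)) : Fin (N + 1) → Vec p) i
      + G.F *ₑ lap a (Fin.cons (-(P.C *ₑ obsErr X h 0 t))
          (fun i => (X.c i t + X.ρ a G.Q i t) • (P.C *ₑ X.ϱ a i t)) :
            Fin (N + 1) → Vec q) i) t := by
  have h1 := hasDerivAt_lap (a := a) H.hasDerivAt_v_sub_w i
  rw [lap_add, lap_add, lap_matVec, lap_matVec, lap_matVec] at h1
  simp only [← ϱ_eq_lap] at h1
  exact h1

/-- The unit vector feedback of the local observers dominates the leader's input. -/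
theorem inner_η_lap_nonpos (H : ClosedLoopAt P G a h u₀ X t ζ₁ ζ₂) (ha : ∀ i j, 0 ≤ a i j)
    (hu : ‖u₀ t‖ ≤ G.β) (i : Fin N) :
    inner ℝ (P.Bᵀ *ₑ G.S *ₑ X.η a i t)
      (lap a (Fin.cons (u₀ t) (fun i => -(G.β • ζ₁ i)) : Fin (N + 1) → Vec p) i) ≤ 0 := by
  have hβ : 0 ≤ G.β := (norm_nonneg _).trans hu
  refine inner_lap_nonpos ha (β := G.β) ?_ fun j => Fin.cases hu (fun k => ?_) j
  · rw [Fin.cons_succ, inner_neg_right, inner_smul_right, inner_eq_norm_of_mem_zSet (H.mem₁ i)]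
  · rw [Fin.cons_succ, norm_neg, norm_smul, Real.norm_of_nonneg hβ]
    exact mul_le_of_le_one_right hβ (norm_le_one_of_mem_zSet (H.mem₁ k))

/-- The unit vector feedback of the distributed observers dominates the leader's input. -/
theorem inner_ϱ_lap_nonpos (H : ClosedLoopAt P G a h u₀ X t ζ₁ ζ₂) (ha : ∀ i j, 0 ≤ a i j)
    (hu : ‖u₀ t‖ ≤ G.β) (i : Fin N) :
    inner ℝ (P.Bᵀ *ₑ G.Q *ₑ X.ϱ a i t)
      (lap a (Fin.cons (-u₀ t) (fun i => -(G.β • ζ₂ i)) : Fin (N + 1) → Vec p) i) ≤ 0 := by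
  have hβ : 0 ≤ G.β := (norm_nonneg _).trans hu
  refine inner_lap_nonpos ha (β := G.β) ?_ fun j => Fin.cases ?_ (fun k => ?_) j
  · rw [Fin.cons_succ, inner_neg_right, inner_smul_right, inner_eq_norm_of_mem_zSet (H.mem₂ i)]
  · rwa [Fin.cons_zero, norm_neg]
  · rw [Fin.cons_succ, norm_neg, norm_smul, Real.norm_of_nonneg hβ]
    exact mul_le_of_le_one_right hβ (norm_le_one_of_mem_zSet (H.mem₂ k))

end ClosedLoopAt

end ErrorEquations

/-! ### The distributed observers -/

section DistributedObserver

variable {N n p q : ℕ} {P : Plant n p q} {G : Gains n p q}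
  {a : Matrix (Fin (N + 1)) (Fin (N + 1)) ℝ} {h : Fin N → ℝ → Vec n} {u₀ : ℝ → Vec p}
  {I : Set ℝ} {X : Histories N n}

theorem Q_matVec_F (hQ : G.Q.PosDef) (hF : G.F = -(G.Q⁻¹ * P.Cᵀ)) :
    G.Q * G.F = -P.Cᵀ := by
  rw [hF, Matrix.mul_neg, ← Matrix.mul_assoc, Matrix.mul_nonsing_inv _
    ((Matrix.isUnit_iff_isUnit_det _).1 hQ.isUnit), Matrix.one_mul]

/-- The output injection `F` solves the Lyapunov inequality for `A + F C`. -/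
theorem observer_lyapunov (hQ : G.Q.PosDef) (hF : G.F = -(G.Q⁻¹ * P.Cᵀ)) :
    G.Q * P.A + P.Aᵀ * G.Q - (2 : ℝ) • (P.Cᵀ * P.C) =
      G.Q * (P.A + G.F * P.C) + (P.A + G.F * P.C)ᵀ * G.Q := by
  have h1 := Q_matVec_F hQ hF
  have h2 : G.Fᵀ * G.Q = -P.C := by
    have := congrArg Matrix.transpose h1
    rwa [Matrix.transpose_mul, hQ.transpose_eq, Matrix.transpose_neg,
      Matrix.transpose_transpose] at this
  rw [Matrix.mul_add, ← Matrix.mul_assoc, h1, Matrix.transpose_add, Matrix.transpose_mul,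
    Matrix.add_mul, Matrix.mul_assoc, h2, two_smul, Matrix.neg_mul, Matrix.mul_neg]
  abel

/-- The Lyapunov function of the distributed observers, with one weight `g i` per follower and a
share `μ` of the leader's observer error. -/
noncomputable def couplingEnergy (G : Gains n p q) (a : Matrix (Fin (N + 1)) (Fin (N + 1)) ℝ)
    (X : Histories N n) (g : Fin N → ℝ) (μ t : ℝ) : ℝ :=
  ∑ i, g i * (X.c i t * X.ρ a G.Q i t + 1 / 2 * (X.ρ a G.Q i t * X.ρ a G.Q i t)) +
    μ * inner ℝ (X.w 0 t - X.x 0 t) (G.Q *ₑ (X.w 0 t - X.x 0 t))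

/-- The part of the Lyapunov function that depends on the coupling weights only, with the opposite
sign and up to a constant: its derivative is `∑ (α - c_i) ċ_i`. -/
noncomputable def weightPotential (X : Histories N n) (α : ℝ) (t : ℝ) : ℝ :=
  ∑ i, (α * X.c i t - 1 / 2 * (X.c i t * X.c i t))

theorem IsClosedLoopSolution.locallyAC_ϱ (hX : IsClosedLoopSolution P G a h u₀ I X) (i : Fin N) :
    LocallyAC I (X.ϱ a i) := by
  have := LocallyAC.lap (a := a) (fun j => (hX.ac_v j).sub (hX.ac_w j)) i
  simpa only [← ϱ_eq_lap] using this

theorem IsClosedLoopSolution.locallyAC_η (hX : IsClosedLoopSolution P G a h u₀ I X) (i : Fin N) :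
    LocallyAC I (X.η a i) :=
  LocallyAC.lap (a := a) hX.ac_w i

theorem IsClosedLoopSolution.locallyAC_couplingEnergy (hX : IsClosedLoopSolution P G a h u₀ I X)
    (g : Fin N → ℝ) (μ : ℝ) : LocallyAC I (couplingEnergy G a X g μ) := by
  have hρ : ∀ i, LocallyAC I (X.ρ a G.Q i) := fun i =>
    (hX.locallyAC_ϱ i).inner ((hX.locallyAC_ϱ i).matVec G.Q)
  have he := (hX.ac_w 0).sub (hX.ac_x 0)
  exact (LocallyAC.sum _ fun i _ => (((hX.ac_c i).mul (hρ i)).add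
    (((hρ i).mul (hρ i)).const_mul (1 / 2))).const_mul (g i)).add
      ((he.inner (he.matVec G.Q)).const_mul μ)

theorem IsClosedLoopSolution.locallyAC_weightPotential
    (hX : IsClosedLoopSolution P G a h u₀ I X) (α : ℝ) : LocallyAC I (weightPotential X α) :=
  LocallyAC.sum _ fun i _ => ((hX.ac_c i).const_mul α).sub
    (((hX.ac_c i).mul (hX.ac_c i)).const_mul (1 / 2))

theorem IsClosedLoopSolution.monotoneOn_c (hI : IsTimeInterval I)
    (hX : IsClosedLoopSolution P G a h u₀ I X) (hΓ : G.Γ = 1) (i : Fin N) :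
    MonotoneOn (X.c i) I := by
  have := hI.ordConnected
  refine (hX.ac_c i).monotoneOn ?_
  filter_upwards [hX.ae_closedLoopAt hI] with t ht htI
  obtain ⟨ζ₁, ζ₂, H⟩ := ht htI
  exact ⟨_, H.hasDerivAt_c hΓ i, sq_nonneg _⟩

theorem IsClosedLoopSolution.one_le_c (hI : IsTimeInterval I)
    (hX : IsClosedLoopSolution P G a h u₀ I X) (hΓ : G.Γ = 1) (i : Fin N) {t : ℝ} (ht : t ∈ I) :
    1 ≤ X.c i t :=
  (hX.init_c i).trans (hX.monotoneOn_c hI hΓ i hI.zero_mem ht (hI.nonneg t ht))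

theorem ρ_nonneg (hQ : G.Q.PosDef) (i : Fin N) (t : ℝ) : 0 ≤ X.ρ a G.Q i t :=
  hQ.inner_matVec_nonneg _

/-- The pointwise estimate behind the adaptive law: the terms of one follower in the derivative of
the Lyapunov function. The quadratic coercivity term `-2 c s²` dominates the linear one
`(3 g + 1) s`, at the price of the constant `α`. -/
theorem follower_estimate {g c α s ρ γ κ w y cy k : ℝ} (hc : 0 < c) (hg : 0 < g)
    (hα : (3 * g + 1) ^ 2 / (8 * c) ≤ α) (hs : s = γ + ρ) (hγ : 1 ≤ γ) (hρ : 0 ≤ ρ)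
    (hκ : 0 < κ) (hw : 0 < w) (hρy : ρ ≤ κ * y) (hk : k ≤ w / κ) (hcy : 0 ≤ cy) :
    g * s * (2 * cy - w * y) + g * cy * ρ - 2 * (c * (s ^ 2 * cy)) ≤
      -k * (g * (γ * ρ + 1 / 2 * (ρ * ρ))) + (α - γ) * cy := by
  have hs0 : 0 < s := by linarith
  have h1 : w / κ * ρ ≤ w * y := by
    rw [div_mul_eq_mul_div, div_le_iff₀ hκ]
    nlinarith
  have h2 : k * (γ * ρ + 1 / 2 * (ρ * ρ)) ≤ s * (w * y) := by
    have h3 : γ * ρ + 1 / 2 * (ρ * ρ) ≤ s * ρ := by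
      rw [hs]
      nlinarith [mul_nonneg hρ hρ]
    have h4 : 0 ≤ γ * ρ + 1 / 2 * (ρ * ρ) := by
      have : 0 ≤ γ * ρ := mul_nonneg (by linarith) hρ
      nlinarith [mul_nonneg hρ hρ]
    calc k * (γ * ρ + 1 / 2 * (ρ * ρ)) ≤ w / κ * (γ * ρ + 1 / 2 * (ρ * ρ)) :=
          mul_le_mul_of_nonneg_right hk h4
      _ ≤ w / κ * (s * ρ) := mul_le_mul_of_nonneg_left h3 (div_pos hw hκ).le
      _ = s * (w / κ * ρ) := by ring
      _ ≤ s * (w * y) := mul_le_mul_of_nonneg_left h1 hs0.le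
  have h5 : 2 * g * s + g * ρ - 2 * c * s ^ 2 ≤ α - γ := by
    have h6 : (3 * g + 1) * s - 2 * c * s ^ 2 ≤ (3 * g + 1) ^ 2 / (8 * c) := by
      rw [le_div_iff₀ (by positivity)]
      nlinarith [sq_nonneg (3 * g + 1 - 4 * c * s)]
    have h7 : g * ρ ≤ g * s := mul_le_mul_of_nonneg_left (by linarith) hg.le
    nlinarith
  have h8 := mul_le_mul_of_nonneg_right h5 hcy
  have h9 := mul_le_mul_of_nonneg_left h2 hg.le
  nlinarith

/-- The dissipation inequality of the distributed observers, with a rate and weights that do not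
depend on the solution. -/
theorem exists_couplingEnergy_dissipation (ha : ∀ i j, 0 ≤ a i j)
    (htree : HasSpanningTreeFrom a 0) (hu₀ : ∀ t, 0 ≤ t → ‖u₀ t‖ ≤ G.β) (hΓ : G.Γ = 1)
    (hQ : G.Q.PosDef)
    (hLMI : (-(G.Q * P.A + P.Aᵀ * G.Q - (2 : ℝ) • (P.Cᵀ * P.C))).PosDef)
    (hF : G.F = -(G.Q⁻¹ * P.Cᵀ)) :
    ∃ (g : Fin N → ℝ) (μ α k : ℝ), (∀ i, 0 < g i) ∧ 0 < μ ∧ 0 < k ∧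
      ∀ (I : Set ℝ) (X : Histories N n), IsTimeInterval I →
        IsClosedLoopSolution P G a h u₀ I X →
        ∀ᵐ t : ℝ, t ∈ I → ∃ d dφ, HasDerivAt (couplingEnergy G a X g μ) d t ∧
          HasDerivAt (weightPotential X α) dφ t ∧
          d ≤ -k * couplingEnergy G a X g μ t + dφ := by
  obtain ⟨g, c, K, hg, hc, hK, hlap⟩ := exists_lap_coercive ha htree
  have hQT := hQ.transpose_eq
  obtain ⟨w, hw, hwW⟩ := hLMI.exists_coercive
  rw [observer_lyapunov hQ hF] at hwW
  obtain ⟨κ, hκ, hκQ⟩ := exists_inner_matVec_bound G.Q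
  obtain ⟨L, hL, hLC⟩ := exists_matVec_bound P.C
  have hκQ' : ∀ x : Vec n, inner ℝ x (G.Q *ₑ x) ≤ κ * ‖x‖ ^ 2 := fun x => by
    simpa [sq] using hκQ x x
  have hQF : ∀ (x : Vec n) (y : Vec q),
      inner ℝ x (G.Q *ₑ G.F *ₑ y) = -inner ℝ (P.C *ₑ x) y := fun x y => by
    rw [matVec_matVec, Q_matVec_F hQ hF, neg_matVec, inner_neg_right, inner_matVec,
      Matrix.transpose_transpose]
  have hQB : ∀ (x : Vec n) (y : Vec p),
      inner ℝ x (G.Q *ₑ P.B *ₑ y) = inner ℝ (P.Bᵀ *ₑ G.Q *ₑ x) y := fun x y => by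
    rw [inner_matVec, hQT, inner_matVec]
  have hWM : ∀ x : Vec n, 2 * inner ℝ x (G.Q *ₑ (P.A + G.F * P.C) *ₑ x) ≤ -(w * ‖x‖ ^ 2) :=
    fun x => by
      have h1 := hwW x
      rw [inner_lyapunov hQT] at h1
      linarith
  have hWA : ∀ x : Vec n, 2 * inner ℝ x (G.Q *ₑ P.A *ₑ x) ≤
      2 * ‖P.C *ₑ x‖ ^ 2 - w * ‖x‖ ^ 2 := fun x => by
    have h1 := hWM x
    rw [add_matVec, matVec_add, inner_add_right, ← matVec_matVec, hQF,
      real_inner_self_eq_norm_sq] at h1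
    linarith
  -- The weight `μ` lets the decay of the leader's observer error absorb its effect on the
  -- followers.
  set μ := (2 * K * L ^ 2 + 1) / w with hμ
  have hμ0 : 0 < μ := by positivity
  set α := ∑ i, (3 * g i + 1) ^ 2 / (8 * c) with hα
  set k := min (w / κ) (1 / (κ * μ)) with hk
  have hk0 : 0 < k := lt_min (by positivity) (by positivity)
  refine ⟨g, μ, α, k, hg, hμ0, hk0, fun I X hI hX => ?_⟩
  filter_upwards [hX.ae_closedLoopAt hI] with t ht htI
  obtain ⟨ζ₁, ζ₂, H⟩ := ht htI
  have hdc := H.hasDerivAt_c hΓ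
  have hdρ : ∀ i, HasDerivAt (X.ρ a G.Q i) _ t := fun i =>
    hasDerivAt_quadraticForm hQT (H.hasDerivAt_ϱ i)
  have hde := H.hasDerivAt_w_sub_x 0
  have hdV := (HasDerivAt.fun_sum (u := Finset.univ) fun i _ =>
    (((hdc i).fun_mul (hdρ i)).fun_add
      (((hdρ i).fun_mul (hdρ i)).const_mul (1 / 2))).const_mul (g i)).fun_add
    ((hasDerivAt_quadraticForm hQT hde).const_mul μ)
  have hdφ := HasDerivAt.fun_sum (u := Finset.univ) fun i _ =>
    ((hdc i).const_mul α).fun_sub (((hdc i).fun_mul (hdc i)).const_mul (1 / 2))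
  refine ⟨_, _, hdV, hdφ, ?_⟩
  set e := X.w 0 t - X.x 0 t with he
  have hshape : shape h 0 t = 0 := by simp [shape]
  rw [hshape, add_zero, matVec_zero, sub_zero]
  set s : Fin N → ℝ := fun i => X.c i t + X.ρ a G.Q i t with hs
  set σ : Fin (N + 1) → Vec q := Fin.cons (-(P.C *ₑ obsErr X h 0 t))
    (fun i => (X.c i t + X.ρ a G.Q i t) • (P.C *ₑ X.ϱ a i t)) with hσ
  have hcoer := hlap σ
  have hσ0 : ‖σ 0‖ ^ 2 ≤ L ^ 2 * ‖e‖ ^ 2 := by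
    have h1 : σ 0 = -(P.C *ₑ e) := by rw [hσ, Fin.cons_zero, obsErr_zero]
    rw [h1, norm_neg, ← mul_pow]
    exact pow_le_pow_left₀ (norm_nonneg _) (hLC e) 2
  have hσi : ∀ i : Fin N, σ i.succ = s i • (P.C *ₑ X.ϱ a i t) := fun i => by
    rw [hσ, Fin.cons_succ]
  have hc1 : ∀ i, 1 ≤ X.c i t := fun i => hX.one_le_c hI hΓ i htI
  have hρ0 : ∀ i, 0 ≤ X.ρ a G.Q i t := fun i => ρ_nonneg hQ i t
  have hs0 : ∀ i, 0 < s i := fun i => by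
    have := hc1 i
    have := hρ0 i
    simp only [hs]
    linarith
  have hstep : ∀ i, g i * (‖P.C *ₑ X.ϱ a i t‖ ^ 2 * X.ρ a G.Q i t + X.c i t *
        (2 * inner ℝ (X.ϱ a i t) (G.Q *ₑ (P.A *ₑ X.ϱ a i t
          + P.B *ₑ lap a (Fin.cons (-u₀ t) (fun i => -(G.β • ζ₂ i)) : Fin (N + 1) → Vec p) i
          + G.F *ₑ lap a σ i))) +
        1 / 2 * ((2 * inner ℝ (X.ϱ a i t) (G.Q *ₑ (P.A *ₑ X.ϱ a i t
          + P.B *ₑ lap a (Fin.cons (-u₀ t) (fun i => -(G.β • ζ₂ i)) : Fin (N + 1) → Vec p) i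
          + G.F *ₑ lap a σ i))) * X.ρ a G.Q i t + X.ρ a G.Q i t *
          (2 * inner ℝ (X.ϱ a i t) (G.Q *ₑ (P.A *ₑ X.ϱ a i t
          + P.B *ₑ lap a (Fin.cons (-u₀ t) (fun i => -(G.β • ζ₂ i)) : Fin (N + 1) → Vec p) i
          + G.F *ₑ lap a σ i))))) ≤
      -k * (g i * (X.c i t * X.ρ a G.Q i t + 1 / 2 * (X.ρ a G.Q i t * X.ρ a G.Q i t))) +
        (α - X.c i t) * ‖P.C *ₑ X.ϱ a i t‖ ^ 2 + 2 * (c * ‖σ i.succ‖ ^ 2)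
        - 2 * (g i * inner ℝ (σ i.succ) (lap a σ i)) := by
    intro i
    have hB := H.inner_ϱ_lap_nonpos ha (hu₀ t H.pos.le) i
    rw [matVec_add, matVec_add, inner_add_right, inner_add_right, hQB, hQF, hσi, norm_smul,
      inner_smul_left, mul_pow, Real.norm_eq_abs, sq_abs]
    have hA := hWA (X.ϱ a i t)
    have hest := follower_estimate (k := k) (α := α) hc (hg i)
      (Finset.single_le_sum (f := fun i => (3 * g i + 1) ^ 2 / (8 * c))
        (fun i _ => by positivity) (Finset.mem_univ i)) (rfl : s i = _) (hc1 i) (hρ0 i) hκ hw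
      (hκQ' (X.ϱ a i t)) (min_le_left _ _) (sq_nonneg ‖P.C *ₑ X.ϱ a i t‖)
    have hgs : 0 < g i * s i := mul_pos (hg i) (hs0 i)
    have h1 := mul_le_mul_of_nonneg_left
      (add_le_add hA (mul_nonpos_of_nonneg_of_nonpos zero_le_two hB)) hgs.le
    simp only [conj_trivial]
    have h2 : s i = X.c i t + X.ρ a G.Q i t := rfl
    rw [h2] at h1 hest ⊢
    linarith
  have hlead : μ * (2 * inner ℝ e (G.Q *ₑ (P.A + G.F * P.C) *ₑ e)) ≤
      -k * (μ * inner ℝ e (G.Q *ₑ e)) - 2 * K * ‖σ 0‖ ^ 2 := by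
    have h1 := mul_le_mul_of_nonneg_left (hWM e) hμ0.le
    have h2 : μ * -(w * ‖e‖ ^ 2) = -((2 * K * L ^ 2 + 1) * ‖e‖ ^ 2) := by
      rw [hμ]
      field_simp
    have h3 : k * (μ * inner ℝ e (G.Q *ₑ e)) ≤ ‖e‖ ^ 2 := by
      have h4 : k * (μ * inner ℝ e (G.Q *ₑ e)) ≤ 1 / (κ * μ) * (μ * (κ * ‖e‖ ^ 2)) :=
        mul_le_mul (min_le_right _ _) (mul_le_mul_of_nonneg_left (hκQ' e) hμ0.le)
          (mul_nonneg hμ0.le (hQ.inner_matVec_nonneg e)) (by positivity)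
      refine h4.trans (le_of_eq ?_)
      field_simp
    have h5 := mul_le_mul_of_nonneg_left hσ0 (by positivity : 0 ≤ 2 * K)
    linarith
  refine (add_le_add (Finset.sum_le_sum fun i _ => hstep i) hlead).trans ?_
  have hφ : ∀ i, α * ‖P.C *ₑ X.ϱ a i t‖ ^ 2 - 1 / 2 * (‖P.C *ₑ X.ϱ a i t‖ ^ 2 * X.c i t +
      X.c i t * ‖P.C *ₑ X.ϱ a i t‖ ^ 2) = (α - X.c i t) * ‖P.C *ₑ X.ϱ a i t‖ ^ 2 := fun i => by
    ring
  simp only [hφ, couplingEnergy, Finset.sum_add_distrib, Finset.sum_sub_distrib,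
    ← Finset.mul_sum, ← he]
  linarith

end DistributedObserver

/-! ### Boundedness of the coupling weights and decay of the relative errors -/

section Coupling

variable {N n p q : ℕ} {P : Plant n p q} {G : Gains n p q}
  {a : Matrix (Fin (N + 1)) (Fin (N + 1)) ℝ} {h : Fin N → ℝ → Vec n} {u₀ : ℝ → Vec p}
  {I : Set ℝ} {X : Histories N n} {g : Fin N → ℝ} {μ : ℝ}

theorem single_le_couplingEnergy (hQ : G.Q.PosDef) (hg : ∀ i, 0 < g i) (hμ : 0 < μ) {t : ℝ}
    (hc : ∀ i, 1 ≤ X.c i t) (i : Fin N) :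
    g i * X.ρ a G.Q i t ≤ couplingEnergy G a X g μ t := by
  have hterm : ∀ j, g j * X.ρ a G.Q j t ≤
      g j * (X.c j t * X.ρ a G.Q j t + 1 / 2 * (X.ρ a G.Q j t * X.ρ a G.Q j t)) := fun j => by
    have hρ := ρ_nonneg (X := X) (a := a) hQ j t
    refine mul_le_mul_of_nonneg_left ?_ (hg j).le
    nlinarith [hc j, mul_nonneg hρ hρ]
  have h1 := Finset.single_le_sum
    (f := fun j => g j * (X.c j t * X.ρ a G.Q j t + 1 / 2 * (X.ρ a G.Q j t * X.ρ a G.Q j t)))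
    (fun j _ => (mul_nonneg (hg j).le (ρ_nonneg hQ j t)).trans (hterm j)) (Finset.mem_univ i)
  have h2 := mul_nonneg hμ.le (hQ.inner_matVec_nonneg (X.w 0 t - X.x 0 t))
  have h3 := hterm i
  unfold couplingEnergy
  linarith

theorem couplingEnergy_nonneg (hQ : G.Q.PosDef) (hg : ∀ i, 0 < g i) (hμ : 0 < μ) {t : ℝ}
    (hc : ∀ i, 1 ≤ X.c i t) : 0 ≤ couplingEnergy G a X g μ t := by
  refine add_nonneg (Finset.sum_nonneg fun i _ => mul_nonneg (hg i).le ?_)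
    (mul_nonneg hμ.le (hQ.inner_matVec_nonneg _))
  have hρ := ρ_nonneg (X := X) (a := a) hQ i t
  nlinarith [hc i, mul_nonneg hρ hρ]

/-- The coupling weights and the relative observer errors of a solution. They are bounded on
bounded and unbounded time intervals alike; if time is unbounded, the weights converge because they
are monotone, and then the dissipation inequality drives the errors to `0`. -/
theorem IsClosedLoopSolution.coupling_bound (ha : ∀ i j, 0 ≤ a i j)
    (htree : HasSpanningTreeFrom a 0) (hu₀ : ∀ t, 0 ≤ t → ‖u₀ t‖ ≤ G.β) (hΓ : G.Γ = 1)
    (hQ : G.Q.PosDef)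
    (hLMI : (-(G.Q * P.A + P.Aᵀ * G.Q - (2 : ℝ) • (P.Cᵀ * P.C))).PosDef)
    (hF : G.F = -(G.Q⁻¹ * P.Cᵀ)) (hI : IsTimeInterval I)
    (hX : IsClosedLoopSolution P G a h u₀ I X) (i : Fin N) :
    ((∃ K, ∀ t ∈ I, ‖X.ϱ a i t‖ ≤ K) ∧ ∃ K, ∀ t ∈ I, |X.c i t| ≤ K) ∧
      (I = Ici 0 → Tendsto (X.ϱ a i) atTop (𝓝 0) ∧ ∃ cLim, Tendsto (X.c i) atTop (𝓝 cLim)) := by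
  obtain ⟨g, μ, α, k, hg, hμ, hk, H⟩ :=
    exists_couplingEnergy_dissipation (h := h) ha htree hu₀ hΓ hQ hLMI hF
  have hdiss := H I X hI hX
  have hord := hI.ordConnected
  have hc1 : ∀ t ∈ I, ∀ i, 1 ≤ X.c i t := fun t ht i => hX.one_le_c hI hΓ i ht
  obtain ⟨m, hm, hmQ⟩ := hQ.exists_coercive
  set V := couplingEnergy G a X g μ with hV
  set φ := weightPotential X α with hφ
  have hV0 : ∀ t ∈ I, 0 ≤ V t := fun t ht => couplingEnergy_nonneg hQ hg hμ (hc1 t ht)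
  have hϱV : ∀ t ∈ I, ∀ i, ‖X.ϱ a i t‖ ^ 2 ≤ (g i * m)⁻¹ * V t := fun t ht i => by
    rw [← div_eq_inv_mul, le_div_iff₀ (mul_pos (hg i) hm)]
    have h1 := mul_le_mul_of_nonneg_left (hmQ (X.ϱ a i t)) (hg i).le
    have h2 := single_le_couplingEnergy (a := a) hQ hg hμ (hc1 t ht) i
    have h3 : X.ρ a G.Q i t = inner ℝ (X.ϱ a i t) (G.Q *ₑ X.ϱ a i t) := rfl
    rw [h3] at h2
    linarith
  have hVac : LocallyAC I V := hX.locallyAC_couplingEnergy g μ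
  have hφac : LocallyAC I φ := hX.locallyAC_weightPotential α
  have hanti : AntitoneOn (fun t => V t - φ t) I := by
    refine (hVac.sub hφac).antitoneOn ?_
    filter_upwards [hdiss] with t ht htI
    obtain ⟨d, dφ, hd, hdφ, hle⟩ := ht htI
    refine ⟨_, hd.fun_sub hdφ, ?_⟩
    have := mul_nonneg hk.le (hV0 t htI)
    linarith
  set E := V 0 - φ 0 + N * (α ^ 2 / 2) with hE
  -- Completing the square in the potential bounds the energy and the weights together.
  have hbound : ∀ t ∈ I, V t + ∑ i, 1 / 2 * (X.c i t - α) ^ 2 ≤ E := fun t ht => by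
    have h1 := hanti hI.zero_mem ht (hI.nonneg t ht)
    have h2 : φ t = N * (α ^ 2 / 2) - ∑ i, 1 / 2 * (X.c i t - α) ^ 2 := by
      have h3 : ∀ i, α * X.c i t - 1 / 2 * (X.c i t * X.c i t) =
          α ^ 2 / 2 - 1 / 2 * (X.c i t - α) ^ 2 := fun i => by ring
      rw [hφ, weightPotential]
      simp only [h3, Finset.sum_sub_distrib]
      simp
    simp only at h1
    linarith
  have hsum0 : ∀ t, 0 ≤ ∑ i, 1 / 2 * (X.c i t - α) ^ 2 := fun t =>
    Finset.sum_nonneg fun i _ => by positivity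
  have hcb : ∀ i, ∀ t ∈ I, |X.c i t| ≤ √(2 * E) + |α| := fun i t ht => by
    have h1 := Finset.single_le_sum (f := fun i => 1 / 2 * (X.c i t - α) ^ 2)
      (fun i _ => by positivity) (Finset.mem_univ i)
    have h2 : |X.c i t - α| ≤ √(2 * E) := Real.abs_le_sqrt (by
      have := hbound t ht
      have := hV0 t ht
      linarith)
    have h3 := abs_add_le (X.c i t - α) α
    rw [sub_add_cancel] at h3
    linarith
  refine ⟨⟨⟨√((g i * m)⁻¹ * E), fun t ht => Real.le_sqrt_of_sq_le ((hϱV t ht i).trans ?_)⟩,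
    _, hcb i⟩, fun hI0 => ?_⟩
  · have := mul_pos (hg i) hm
    exact mul_le_mul_of_nonneg_left (by linarith [hbound t ht, hsum0 t]) (by positivity)
  subst hI0
  have hconv : ∀ i, ∃ cLim, Tendsto (X.c i) atTop (𝓝 cLim) := fun i => by
    -- The weight is monotone on `[0, ∞)` only, so it is extended to the left by a constant.
    have hmono : Monotone fun t => X.c i (max 0 t) := fun s t hst =>
      hX.monotoneOn_c hI hΓ i (le_max_left 0 s) (le_max_left 0 t) (max_le_max le_rfl hst)
    refine ⟨_, (tendsto_atTop_ciSup hmono ⟨√(2 * E) + |α|, ?_⟩).congr' ?_⟩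
    · rintro _ ⟨t, rfl⟩
      exact (le_abs_self _).trans (hcb i _ (le_max_left 0 t))
    · filter_upwards [eventually_ge_atTop 0] with t ht
      rw [max_eq_right ht]
  refine ⟨?_, hconv i⟩
  choose cl hcl using hconv
  have hφl : Tendsto φ atTop (𝓝 (∑ i, (α * cl i - 1 / 2 * (cl i * cl i)))) :=
    tendsto_finsetSum _ fun i _ =>
      ((hcl i).const_mul α).sub (((hcl i).mul (hcl i)).const_mul (1 / 2))
  have hVlim : Tendsto V atTop (𝓝 0) := by
    refine tendsto_zero_of_deriv_le hk hVac hV0 hφac hφl (r := fun _ => 0) tendsto_const_nhds ?_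
    simpa only [add_zero] using hdiss
  rw [tendsto_zero_iff_norm_tendsto_zero]
  have hsq : Tendsto (fun t => ‖X.ϱ a i t‖ ^ 2) atTop (𝓝 0) := by
    refine squeeze_zero' (Eventually.of_forall fun t => sq_nonneg _) ?_
      (by simpa only [mul_zero] using hVlim.const_mul (g i * m)⁻¹)
    filter_upwards [eventually_ge_atTop 0] with t ht using hϱV t ht i
  simpa [Real.sqrt_sq] using hsq.sqrt

/-! ### The local observers -/

/-- The relative local observer states `η` are input-to-state stable with respect to the relative
distributed observer errors and the local observer errors. -/
theorem exists_η_dissipation (ha : ∀ i j, 0 ≤ a i j)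
    (hu₀ : ∀ t, 0 ≤ t → ‖u₀ t‖ ≤ G.β) (hS : G.S.PosDef)
    (hSLMI : (-(G.S * (P.A + P.B * G.K₂) + (P.A + P.B * G.K₂)ᵀ * G.S)).PosDef) :
    ∃ k K : ℝ, 0 < k ∧ 0 ≤ K ∧ ∀ {X : Histories N n} {t : ℝ} {ζ₁ ζ₂ : Fin N → Vec p},
      ClosedLoopAt P G a h u₀ X t ζ₁ ζ₂ → ∀ i, ∃ d,
        HasDerivAt (fun t => inner ℝ (X.η a i t) (G.S *ₑ X.η a i t)) d t ∧
        d ≤ -k * inner ℝ (X.η a i t) (G.S *ₑ X.η a i t) +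
          K * (‖X.ϱ a i t‖ ^ 2 + ‖lap a (fun j => obsErr X h j t) i‖ ^ 2) := by
  have hST := hS.transpose_eq
  obtain ⟨w, hw, hwW⟩ := hSLMI.exists_coercive
  obtain ⟨κ, hκ, hκS⟩ := exists_inner_matVec_bound G.S
  obtain ⟨L₁, hL₁, h₁⟩ := exists_inner_matVec_bound (G.S * (P.B * G.K₂))
  obtain ⟨L₂, hL₂, h₂⟩ := exists_inner_matVec_bound (G.S * (G.F * P.C))
  refine ⟨w / (2 * κ), 4 / w * (L₁ ^ 2 + L₂ ^ 2), by positivity, by positivity, ?_⟩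
  intro X t ζ₁ ζ₂ H i
  refine ⟨_, hasDerivAt_quadraticForm hST (H.hasDerivAt_η i), ?_⟩
  have hB := H.inner_η_lap_nonpos ha (hu₀ t H.pos.le) i
  have hSB : ∀ (x : Vec n) (y : Vec p),
      inner ℝ x (G.S *ₑ P.B *ₑ y) = inner ℝ (P.Bᵀ *ₑ G.S *ₑ x) y := fun x y => by
    rw [inner_matVec, hST, inner_matVec]
  rw [← hSB] at hB
  set y := X.η a i t
  set r := X.ϱ a i t
  set e := lap a (fun j => obsErr X h j t) i
  rw [matVec_add, matVec_add, matVec_add, inner_add_right, inner_add_right, inner_add_right,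
    matVec_matVec G.S (P.B * G.K₂), matVec_matVec G.S (G.F * P.C)]
  have hA := hwW y
  rw [inner_lyapunov hST] at hA
  -- Young's inequality, with a quarter of the decay rate spent on each perturbation.
  have young : ∀ L b : ℝ, 2 * (L * (‖y‖ * b)) ≤ w / 4 * ‖y‖ ^ 2 + 4 / w * L ^ 2 * b ^ 2 :=
    fun L b => by
      have h3 : w / 4 * ‖y‖ ^ 2 + 4 / w * L ^ 2 * b ^ 2 - 2 * (L * (‖y‖ * b)) =
          (w * ‖y‖ - 4 * L * b) ^ 2 / (4 * w) := by
        field_simp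
        ring
      have h4 : 0 ≤ (w * ‖y‖ - 4 * L * b) ^ 2 / (4 * w) := by positivity
      linarith
  have h5 := young L₁ ‖r‖
  have h6 := young L₂ ‖e‖
  have h7 : w / (2 * κ) * inner ℝ y (G.S *ₑ y) ≤ w / 2 * ‖y‖ ^ 2 := by
    refine (mul_le_mul_of_nonneg_left (hκS y y) (by positivity)).trans (le_of_eq ?_)
    field_simp
  have h8 : 0 ≤ 4 / w * L₁ ^ 2 * ‖e‖ ^ 2 := by positivity
  have h9 : 0 ≤ 4 / w * L₂ ^ 2 * ‖r‖ ^ 2 := by positivity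
  linarith [h₁ y r, h₂ y e]

/-- Bounded, respectively vanishing, perturbations produce bounded, respectively vanishing, relative
local observer states. -/
theorem IsClosedLoopSolution.η_bound (ha : ∀ i j, 0 ≤ a i j)
    (hu₀ : ∀ t, 0 ≤ t → ‖u₀ t‖ ≤ G.β) (hS : G.S.PosDef)
    (hSLMI : (-(G.S * (P.A + P.B * G.K₂) + (P.A + P.B * G.K₂)ᵀ * G.S)).PosDef)
    (hI : IsTimeInterval I) (hX : IsClosedLoopSolution P G a h u₀ I X) (i : Fin N) :
    ((∃ K, ∀ t ∈ I, ‖X.ϱ a i t‖ ≤ K) → (∀ j, ∃ K, ∀ t ∈ I, ‖obsErr X h j t‖ ≤ K) →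
      ∃ K, ∀ t ∈ I, ‖X.η a i t‖ ≤ K) ∧
    (I = Ici 0 → Tendsto (X.ϱ a i) atTop (𝓝 0) →
      (∀ j, Tendsto (obsErr X h j) atTop (𝓝 0)) → Tendsto (X.η a i) atTop (𝓝 0)) := by
  obtain ⟨k, K, hk, hK, hdiss⟩ := exists_η_dissipation (a := a) (h := h) ha hu₀ hS hSLMI
  obtain ⟨m, hm, hmS⟩ := hS.exists_coercive
  have hord := hI.ordConnected
  have hηac := hX.locallyAC_η i
  have hVac := hηac.inner (hηac.matVec G.S)
  have hV0 : ∀ t, 0 ≤ inner ℝ (X.η a i t) (G.S *ₑ X.η a i t) := fun t =>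
    hS.inner_matVec_nonneg _
  have hηV : ∀ t, ‖X.η a i t‖ ^ 2 ≤ m⁻¹ * inner ℝ (X.η a i t) (G.S *ₑ X.η a i t) := fun t => by
    rw [← div_eq_inv_mul, le_div_iff₀ hm]
    linarith [hmS (X.η a i t)]
  refine ⟨fun ⟨R, hR⟩ he => ?_, fun hI0 hϱ he => ?_⟩
  · choose Ke hKe using he
    obtain ⟨La, hLa, hlap⟩ := exists_norm_lap_le (n := n) a
    set c := ∑ j, |Ke j| with hc
    have hec : ∀ t ∈ I, ∀ j, ‖obsErr X h j t‖ ≤ c := fun t ht j =>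
      (hKe j t ht).trans ((le_abs_self _).trans (Finset.single_le_sum (f := fun j => |Ke j|)
        (fun j _ => abs_nonneg _) (Finset.mem_univ j)))
    set D := K * (R ^ 2 + (La * c) ^ 2) with hD
    -- The level `D / k` is attracting.
    have hanti := (hVac.sub (locallyAC_const (D / k))).antitoneOn_mul_exp (k := k) (by
      filter_upwards [hX.ae_closedLoopAt hI] with t ht htI
      obtain ⟨ζ₁, ζ₂, H⟩ := ht htI
      obtain ⟨d, hd, hle⟩ := hdiss H i
      refine ⟨_, hd.sub_const _, ?_⟩
      have h1 : K * (‖X.ϱ a i t‖ ^ 2 + ‖lap a (fun j => obsErr X h j t) i‖ ^ 2) ≤ D := by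
        refine mul_le_mul_of_nonneg_left (add_le_add ?_ ?_) hK
        · exact pow_le_pow_left₀ (norm_nonneg _) (hR t htI) 2
        · exact pow_le_pow_left₀ (norm_nonneg _) (hlap _ i c (hec t htI)) 2
      have h2 : k * (D / k) = D := by field_simp
      linarith)
    set V₀ := inner ℝ (X.η a i 0) (G.S *ₑ X.η a i 0) with hV₀
    refine ⟨√(m⁻¹ * (V₀ + |D / k| + D / k)), fun t ht =>
      Real.le_sqrt_of_sq_le ((hηV t).trans (mul_le_mul_of_nonneg_left ?_ (inv_pos.2 hm).le))⟩
    have h1 := hanti hI.zero_mem ht (hI.nonneg t ht)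
    simp only [mul_zero, Real.exp_zero, mul_one] at h1
    have h2 : (1 : ℝ) ≤ Real.exp (k * t) := Real.one_le_exp (mul_nonneg hk.le (hI.nonneg t ht))
    by_contra! hlt
    have h3 : 0 ≤ V₀ + |D / k| := add_nonneg (hV0 0) (abs_nonneg _)
    have h4 : V₀ + |D / k| < inner ℝ (X.η a i t) (G.S *ₑ X.η a i t) - D / k := by linarith
    have h5 := le_mul_of_one_le_right (h3.trans h4.le) h2
    have h6 := neg_abs_le (D / k)
    linarith
  · subst hI0
    have hlap : Tendsto (fun t => lap a (fun j => obsErr X h j t) i) atTop (𝓝 0) := by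
      have := tendsto_finsetSum Finset.univ fun j (_ : j ∈ Finset.univ) =>
        ((he i.succ).sub (he j)).const_smul (a i.succ j)
      simp only [sub_self, smul_zero, Finset.sum_const_zero] at this
      exact this
    have hr : Tendsto (fun t => K * (‖X.ϱ a i t‖ ^ 2 +
        ‖lap a (fun j => obsErr X h j t) i‖ ^ 2)) atTop (𝓝 0) := by
      have := ((hϱ.norm.pow 2).add (hlap.norm.pow 2)).const_mul K
      simpa using this
    have hV := tendsto_zero_of_deriv_le hk hVac (fun t _ => hV0 t)
      (locallyAC_const (0 : ℝ)) tendsto_const_nhds hr (by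
        filter_upwards [hX.ae_closedLoopAt hI] with t ht htI
        obtain ⟨ζ₁, ζ₂, H⟩ := ht htI
        obtain ⟨d, hd, hle⟩ := hdiss H i
        exact ⟨d, 0, hd, hasDerivAt_const _ _, by simpa using hle⟩)
    rw [tendsto_zero_iff_norm_tendsto_zero]
    have hsq : Tendsto (fun t => ‖X.η a i t‖ ^ 2) atTop (𝓝 0) :=
      squeeze_zero (fun t => sq_nonneg _) hηV
        (by simpa only [mul_zero] using hV.const_mul m⁻¹)
    simpa [Real.sqrt_sq] using hsq.sqrt

/-! ### Boundedness and formation tracking -/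

/-- The leader is driven by a bounded input, so its state stays bounded on bounded intervals. -/
theorem IsClosedLoopSolution.exists_bound_leader {T ε : ℝ} (hT : 0 < T)
    (hu₀ : ∀ t, 0 ≤ t → ‖u₀ t‖ ≤ ε) (hX : IsClosedLoopSolution P G a h u₀ (Ico 0 T) X) :
    ∃ K, ∀ t ∈ Ico 0 T, ‖X.x 0 t‖ ≤ K := by
  obtain ⟨LA, hLA, hA⟩ := exists_matVec_bound P.A
  obtain ⟨LB, hLB, hB⟩ := exists_matVec_bound P.B
  refine (hX.ac_x 0).exists_bound_of_norm_deriv_le (c := LB * ε) hT hLA.le ?_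
  filter_upwards [hX.leader] with t ht htI
  refine ⟨_, (ht htI).1, (norm_add_le _ _).trans (add_le_add (hA _) ((hB _).trans ?_))⟩
  exact mul_le_mul_of_nonneg_left (hu₀ t htI.1) hLB.le

/-- Bounds on the observer errors, the relative observer states and the leader bound everything. -/
theorem Histories.exists_bound (ha : ∀ i j, 0 ≤ a i j) (htree : HasSpanningTreeFrom a 0)
    {I : Set ℝ} {X : Histories N n} (hv : ∀ t ∈ I, X.v 0 t = 0)
    (hc : ∀ i, ∃ K, ∀ t ∈ I, |X.c i t| ≤ K) (hϱ : ∀ i, ∃ K, ∀ t ∈ I, ‖X.ϱ a i t‖ ≤ K)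
    (hη : ∀ i, ∃ K, ∀ t ∈ I, ‖X.η a i t‖ ≤ K)
    (he : ∀ j, ∃ K, ∀ t ∈ I, ‖obsErr X h j t‖ ≤ K)
    (hs : ∀ j, ∃ K, ∀ t ∈ I, ‖shape h j t‖ ≤ K) (hx : ∃ K, ∀ t ∈ I, ‖X.x 0 t‖ ≤ K) :
    ∃ M : ℝ, ∀ t ∈ I,
      (∀ j, ‖X.x j t‖ ≤ M ∧ ‖X.w j t‖ ≤ M ∧ ‖X.v j t‖ ≤ M) ∧ ∀ i, |X.c i t| ≤ M := by
  obtain ⟨La, hLa, hlap⟩ := exists_norm_sub_le_lap ha htree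
  -- A common bound for all the given signals
  obtain ⟨R, hR0, hR⟩ : ∃ R : ℝ, 0 ≤ R ∧ ∀ t ∈ I, (∀ i, |X.c i t| ≤ R ∧ ‖X.ϱ a i t‖ ≤ R ∧
      ‖X.η a i t‖ ≤ R) ∧ (∀ j, ‖obsErr X h j t‖ ≤ R ∧ ‖shape h j t‖ ≤ R) ∧ ‖X.x 0 t‖ ≤ R := by
    choose K₁ h₁ using hc
    choose K₂ h₂ using hϱ
    choose K₃ h₃ using hη
    choose K₄ h₄ using he
    choose K₅ h₅ using hs
    obtain ⟨K₆, h₆⟩ := hx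
    have single : ∀ {m : ℕ} (K : Fin m → ℝ) (i : Fin m), K i ≤ ∑ i, |K i| := fun K i =>
      (le_abs_self _).trans (Finset.single_le_sum (f := fun i => |K i|)
        (fun i _ => abs_nonneg _) (Finset.mem_univ i))
    have nn : ∀ {m : ℕ} (K : Fin m → ℝ), 0 ≤ ∑ i, |K i| := fun K =>
      Finset.sum_nonneg fun i _ => abs_nonneg _
    have n₁ := nn K₁
    have n₂ := nn K₂
    have n₃ := nn K₃
    have n₄ := nn K₄
    have n₅ := nn K₅
    have n₆ := abs_nonneg K₆
    refine ⟨∑ i, |K₁ i| + ∑ i, |K₂ i| + ∑ i, |K₃ i| + ∑ j, |K₄ j| + ∑ j, |K₅ j| + |K₆|,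
      by positivity, fun t ht => ⟨fun i => ⟨?_, ?_, ?_⟩, fun j => ⟨?_, ?_⟩, ?_⟩⟩
    · linarith [h₁ i t ht, single K₁ i]
    · linarith [h₂ i t ht, single K₂ i]
    · linarith [h₃ i t ht, single K₃ i]
    · linarith [h₄ j t ht, single K₄ j]
    · linarith [h₅ j t ht, single K₅ j]
    · linarith [h₆ t ht, le_abs_self K₆]
  set D := √(La * (N * R ^ 2)) with hD
  have hD0 : 0 ≤ D := Real.sqrt_nonneg _
  have hdev : ∀ y : Fin (N + 1) → Vec n, (∀ i, ‖lap a y i‖ ≤ R) → ∀ i : Fin N,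
      ‖y i.succ - y 0‖ ≤ D := fun y hy i => by
    refine Real.le_sqrt_of_sq_le ((hlap y i).trans (mul_le_mul_of_nonneg_left ?_ hLa))
    refine (Finset.sum_le_sum fun i _ => pow_le_pow_left₀ (norm_nonneg _) (hy i) 2).trans ?_
    simp
  refine ⟨2 * D + 4 * R, fun t ht => ?_⟩
  obtain ⟨hf, hj, hx0⟩ := hR t ht
  have hw0 : ‖X.w 0 t‖ ≤ 2 * R := by
    have h1 : X.w 0 t = obsErr X h 0 t + X.x 0 t := by rw [obsErr_zero, sub_add_cancel]
    rw [h1]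
    exact (norm_add_le _ _).trans (by linarith [(hj 0).1])
  have hw : ∀ j, ‖X.w j t‖ ≤ D + 2 * R := Fin.cases (by linarith) fun i => by
    have h1 := hdev (fun j => X.w j t) (fun i => (hf i).2.2) i
    have h2 := norm_add_le (X.w i.succ t - X.w 0 t) (X.w 0 t)
    rw [sub_add_cancel] at h2
    linarith
  refine ⟨fun j => ⟨?_, (hw j).trans (by linarith), ?_⟩, fun i => (hf i).1.trans (by linarith)⟩
  · have h1 : X.x j t = X.w j t + shape h j t - obsErr X h j t := by
      rw [obsErr]
      abel
    rw [h1]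
    refine (norm_sub_le _ _).trans ?_
    have := norm_add_le (X.w j t) (shape h j t)
    linarith [hw j, hj j]
  · refine Fin.cases ?_ (fun i => ?_) j
    · rw [hv t ht, norm_zero]
      positivity
    · have h1 := hdev (fun j => X.v j t - X.w j t) (fun i => by
        rw [← ϱ_eq_lap]
        exact (hf i).2.1) i
      simp only [hv t ht, zero_sub, sub_neg_eq_add] at h1
      have h2 : X.v i.succ t = X.v i.succ t - X.w i.succ t + X.w 0 t
          + (X.w i.succ t - X.w 0 t) := by abel
      have h3 := hdev (fun j => X.w j t) (fun i => (hf i).2.2) i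
      rw [h2]
      refine (norm_add_le _ _).trans ?_
      linarith

/-- If the observer errors and the relative local observer states vanish asymptotically, then the
followers attain the formation. -/
theorem Histories.tendsto_tracking (ha : ∀ i j, 0 ≤ a i j) (htree : HasSpanningTreeFrom a 0)
    {X : Histories N n} (hη : ∀ i, Tendsto (X.η a i) atTop (𝓝 0))
    (he : ∀ j, Tendsto (obsErr X h j) atTop (𝓝 0)) (i : Fin N) :
    Tendsto (fun t => X.x i.succ t - X.x 0 t - h i t) atTop (𝓝 0) := by
  obtain ⟨La, hLa, hlap⟩ := exists_norm_sub_le_lap ha htree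
  have hw : Tendsto (fun t => X.w i.succ t - X.w 0 t) atTop (𝓝 0) := by
    rw [tendsto_zero_iff_norm_tendsto_zero]
    have hsum : Tendsto (fun t => La * ∑ k, ‖X.η a k t‖ ^ 2) atTop (𝓝 0) := by
      have := (tendsto_finsetSum Finset.univ fun k (_ : k ∈ Finset.univ) =>
        (hη k).norm.pow 2).const_mul La
      simpa using this
    have hsq : Tendsto (fun t => ‖X.w i.succ t - X.w 0 t‖ ^ 2) atTop (𝓝 0) :=
      squeeze_zero (fun t => sq_nonneg _) (fun t => hlap (fun j => X.w j t) i) hsum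
    simpa [Real.sqrt_sq] using hsq.sqrt
  have h1 := (hw.sub (he i.succ)).add (he 0)
  simp only [sub_zero, add_zero] at h1
  refine h1.congr fun t => ?_
  rw [obsErr_zero, obsErr_succ]
  abel

end Coupling

end FormationTracking

open FormationTracking in
theorem mainTheorem1 {N n p q : ℕ} (P : Plant n p q) (G : Gains n p q)
    (a : Matrix (Fin (N + 1)) (Fin (N + 1)) ℝ) (h : Fin N → ℝ → Vec n)
    (u₀ : ℝ → Vec p) (ε : ℝ)
    (hstab : P.IsStabilizable) (hdet : P.IsDetectable)
    (ha : ∀ i j, 0 ≤ a i j) (ha0 : ∀ j, a 0 j = 0) (htree : HasSpanningTreeFrom a 0)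
    (hε : 0 < ε) (hu₀ : ∀ t, 0 ≤ t → ‖u₀ t‖ ≤ ε)
    (hh : ∀ i, IsShapeSignal P G.K₁ (h i))
    (hK₂ : IsHurwitz (P.A + P.B * G.K₂))
    (hΓ : G.Γ = 1)
    (hQ : G.Q.PosDef)
    (hLMI : (-(G.Q * P.A + P.Aᵀ * G.Q - (2 : ℝ) • (P.Cᵀ * P.C))).PosDef)
    (hF : G.F = -(G.Q⁻¹ * P.Cᵀ))
    (hβ : ε ≤ G.β)
    (hS : G.S.PosDef)
    (hSLMI : (-(G.S * (P.A + P.B * G.K₂) + (P.A + P.B * G.K₂)ᵀ * G.S)).PosDef) :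
    (∀ (T : ℝ) (X : Histories N n), 0 < T →
      IsClosedLoopSolution P G a h u₀ (Set.Ico 0 T) X →
      ∃ M : ℝ, ∀ t ∈ Set.Ico 0 T,
        (∀ j, ‖X.x j t‖ ≤ M ∧ ‖X.w j t‖ ≤ M ∧ ‖X.v j t‖ ≤ M) ∧ ∀ i, |X.c i t| ≤ M) ∧
    (∀ X : Histories N n, IsClosedLoopSolution P G a h u₀ (Set.Ici 0) X → ∀ i : Fin N,
      Filter.Tendsto (fun t => ‖P.C *ₑ X.x i.succ t - P.C *ₑ X.x 0 t - P.C *ₑ h i t‖)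
        Filter.atTop (nhds 0) ∧
      ∃ cLim : ℝ, Filter.Tendsto (X.c i) Filter.atTop (nhds cLim)) := by
  have hu : ∀ t, 0 ≤ t → ‖u₀ t‖ ≤ G.β := fun t ht => (hu₀ t ht).trans hβ
  have hcoupling := fun {I : Set ℝ} (hI : IsTimeInterval I) {X : Histories N n}
      (hX : IsClosedLoopSolution P G a h u₀ I X) =>
    hX.coupling_bound ha htree hu hΓ hQ hLMI hF hI
  have herr : ∀ {I : Set ℝ}, IsTimeInterval I → ∀ {X : Histories N n},
      IsClosedLoopSolution P G a h u₀ I X → ∀ j,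
      (∃ K, ∀ t ∈ I, ‖obsErr X h j t‖ ≤ K) ∧
        (I = Set.Ici 0 → Filter.Tendsto (obsErr X h j) Filter.atTop (nhds 0)) := by
    intro I hI X hX j
    refine observerError_bound (M := P.A + G.F * P.C) hQ ?_ hI (isShapeSignal_shape hh j)
      ((hX.ac_w j).sub (hX.ac_x j)) ?_
    · rwa [← observer_lyapunov hQ hF]
    · filter_upwards [hX.ae_closedLoopAt hI] with t ht htI
      obtain ⟨ζ₁, ζ₂, H⟩ := ht htI
      exact H.hasDerivAt_w_sub_x j
  refine ⟨fun T X hT hX => ?_, fun X hX i => ?_⟩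
  · have hI := isTimeInterval_Ico hT
    have hϱ := fun i => (hcoupling hI hX i).1.1
    have he := fun j => (herr hI hX j).1
    refine Histories.exists_bound (h := h) ha htree hX.leader_v (fun i => (hcoupling hI hX i).1.2)
      hϱ (fun i => (hX.η_bound ha hu hS hSLMI hI i).1 (hϱ i) he) he (fun j => ?_)
      (hX.exists_bound_leader hT hu₀)
    obtain ⟨K, hK⟩ := (isShapeSignal_shape hh j).exists_bound T
    exact ⟨K, fun t ht => hK t (Set.Ico_subset_Icc_self ht)⟩
  · have hI := isTimeInterval_Ici
    have he := fun j => (herr hI hX j).2 rfl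
    have hη := fun i => (hX.η_bound ha hu hS hSLMI hI i).2 rfl ((hcoupling hI hX i).2 rfl).1 he
    refine ⟨?_, ((hcoupling hI hX i).2 rfl).2⟩
    obtain ⟨L, hL, hC⟩ := exists_matVec_bound P.C
    have h1 := (Histories.tendsto_tracking ha htree hη he i).norm.const_mul L
    rw [norm_zero, mul_zero] at h1
    refine squeeze_zero (fun t => norm_nonneg _) (fun t => ?_) h1
    rw [← matVec_sub, ← matVec_sub]
    exact hC _
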